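/- Let $n\in\mathbb N_0$ and $\mu\in\mathbb R$. Let $\mathcal D$ be the space of all $(u_0,u_1)\in L^2(\mathbb R^n)\times H^{-1}(\mathbb R^n)$ with $0\notin\operatorname{supp}\widehat u_0$ and $0\notin\operatorname{supp}\widehat u_1$. Then there is a linear map $W:(u_0,u_1)\mapsto(w_0,w_1)$ from $\mathcal D$ to $L^2(\mathbb R^n)\times H^{-1}(\mathbb R^n)$ with the following property. For every $\varepsilon>0$ there is a constant $C=C(n,\mu,\varepsilon)$ such that, for all $(u_0,u_1)\in\mathcal D$ with $|\xi|\ge\varepsilon$ for every $\xi\in\operatorname{supp}\widehat u_0\cup\operatorname{supp}\widehat u_1$, and with $(w_0,w_1)=W(u_0,u_1)$: (i) $\|w_0\|_{L^2}+\|w_1\|_{H^{-1}}\le C\,\big(\|u_0\|_{L^2}+\|u_1\|_{H^{-1}}\big)$, that is, $W$ is bounded on $L^2\times H^{-1}$ as long as the Fourier supports keep a fixed distance from $0$; (ii) there is a free wave $w\in C^2(\mathbb R;\mathscr S'(\mathbb R^n))$, that is, a solution of $$w_{tt}-\Delta w=0,\qquad w(1,\cdot)=w_0,\quad w_t(1,\cdot)=w_1,$$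 such that every solution $u\in C^2([1,\infty);\mathscr S'(\mathbb R^n))$ of the weakly damped wave equation $$u_{tt}-\Delta u+\frac{2\mu}{t}u_t=0,\qquad u(1,\cdot)=u_0,\quad u_t(1,\cdot)=u_1,$$ satisfies, for all $t\ge1$, $$\|t^\mu u(t,\cdot)-w(t,\cdot)\|_{L^2}\le C\,t^{-1}\big(\|u_0\|_{L^2}+\|u_1\|_{H^{-1}}\big).$$ -/

import Mathlib

open MeasureTheory FourierTransform
open scoped SchwartzMap Laplacian ENNReal NNReal

noncomputable section

namespace WeakDamping

/-- The Euclidean space `ℝⁿ`. -/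
abbrev Space (n : ℕ) : Type := EuclideanSpace ℝ (Fin n)

/-- The `L²` norm of a tempered distribution, equal to `∞` if it is not an `L²` function. -/
def l2Norm {n : ℕ} (f : 𝓢'(Space n, ℂ)) : ℝ≥0∞ :=
  ⨅ (g : Lp ℂ 2 (volume : Measure (Space n))) (_ : f = Lp.toTemperedDistribution g), ‖g‖ₑ

/-- The norm of the Sobolev (Bessel potential) space `H ^ s = H ^ {s, 2}` of a tempered
distribution, equal to `∞` if it does not belong to this space. It uses the weight
`(1 + |ξ| ^ 2) ^ (s / 2)` in the frequency variable of the Fourier transform with kernel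
`exp (-2 π i x · ξ)`; the weight `(1 + 4 π ^ 2 |ξ| ^ 2) ^ (s / 2)` yields an equivalent norm. -/
def sobolevNorm {n : ℕ} (s : ℝ) (f : 𝓢'(Space n, ℂ)) : ℝ≥0∞ :=
  l2Norm (TemperedDistribution.besselPotential (Space n) ℂ s f)

/-- The support of the Fourier transform of a tempered distribution. -/
def fourierSupport {n : ℕ} (f : 𝓢'(Space n, ℂ)) : Set (Space n) :=
  Distribution.dsupport (𝓕 f : 𝓢'(Space n, ℂ))

theorem zero_notMem_fourierSupport_zero {n : ℕ} :
    (0 : Space n) ∉ fourierSupport (0 : 𝓢'(Space n, ℂ)) := by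
  rw [fourierSupport, Distribution.notMem_dsupport_iff]
  exact ⟨Set.univ, fun φ _ => by simp, isOpen_univ, trivial⟩

theorem zero_notMem_fourierSupport_add {n : ℕ} {f g : 𝓢'(Space n, ℂ)}
    (hf : 0 ∉ fourierSupport f) (hg : 0 ∉ fourierSupport g) : 0 ∉ fourierSupport (f + g) := by
  rw [fourierSupport, Distribution.notMem_dsupport_iff] at hf hg ⊢
  obtain ⟨s, hs, hso, h0s⟩ := hf
  obtain ⟨r, hr, hro, h0r⟩ := hg
  refine ⟨s ∩ r, fun φ hφ => ?_, hso.inter hro, h0s, h0r⟩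
  have h1 : f (𝓕 φ) = 0 := hs φ (hφ.trans Set.inter_subset_left)
  have h2 : g (𝓕 φ) = 0 := hr φ (hφ.trans Set.inter_subset_right)
  change f (𝓕 φ) + g (𝓕 φ) = 0
  rw [h1, h2, add_zero]

theorem zero_notMem_fourierSupport_smul {n : ℕ} (c : ℂ) {f : 𝓢'(Space n, ℂ)}
    (hf : 0 ∉ fourierSupport f) : 0 ∉ fourierSupport (c • f) := by
  rw [fourierSupport, Distribution.notMem_dsupport_iff] at hf ⊢
  obtain ⟨s, hs, hso, h0s⟩ := hf
  refine ⟨s, fun φ hφ => ?_, hso, h0s⟩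
  have h1 : f (𝓕 φ) = 0 := hs φ hφ
  change c • f (𝓕 φ) = 0
  rw [h1, smul_zero]

/-- The Cauchy data `(u₀, u₁) ∈ L² × H⁻¹` such that `0` belongs neither to the support of the
Fourier transform of `u₀` nor to that of `u₁`. -/
def admissibleData (n : ℕ) : Submodule ℂ (𝓢'(Space n, ℂ) × 𝓢'(Space n, ℂ)) where
  carrier := {d | (TemperedDistribution.MemSobolev 0 2 d.1 ∧
      TemperedDistribution.MemSobolev (-1) 2 d.2) ∧
      (0 ∉ fourierSupport d.1 ∧ 0 ∉ fourierSupport d.2)}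
  zero_mem' := ⟨⟨TemperedDistribution.memSobolev_fun_zero _ _ 0 2,
      TemperedDistribution.memSobolev_fun_zero _ _ (-1) 2⟩,
    zero_notMem_fourierSupport_zero, zero_notMem_fourierSupport_zero⟩
  add_mem' := fun ha hb => ⟨⟨ha.1.1.add hb.1.1, ha.1.2.add hb.1.2⟩,
    zero_notMem_fourierSupport_add ha.2.1 hb.2.1, zero_notMem_fourierSupport_add ha.2.2 hb.2.2⟩
  smul_mem' := fun c _ ha => ⟨⟨ha.1.1.smul c, ha.1.2.smul c⟩,
    zero_notMem_fourierSupport_smul c ha.2.1, zero_notMem_fourierSupport_smul c ha.2.2⟩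

/-- `u ∈ C²(I; 𝓢'(ℝⁿ))` solves the Cauchy problem
`u_tt - Δ u + b(t) u_t = 0` for `t ∈ I`, `u(1) = u₀`, `u_t(1) = u₁`.

Differentiability and continuity in `𝓢'(ℝⁿ)` are tested by pairing with each Schwartz function;
at an end point of `I` the derivatives are one-sided. -/
def SolvesCauchyProblem {n : ℕ} (b : ℝ → ℝ) (I : Set ℝ) (u : ℝ → 𝓢'(Space n, ℂ))
    (u₀ u₁ : 𝓢'(Space n, ℂ)) : Prop :=
  ∃ ut utt : ℝ → 𝓢'(Space n, ℂ),
    (∀ φ : 𝓢(Space n, ℂ), ∀ t ∈ I, HasDerivWithinAt (fun s => u s φ) (ut t φ) I t) ∧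
    (∀ φ : 𝓢(Space n, ℂ), ∀ t ∈ I, HasDerivWithinAt (fun s => ut s φ) (utt t φ) I t) ∧
    (∀ φ : 𝓢(Space n, ℂ), ContinuousOn (fun s => utt s φ) I) ∧
    (∀ t ∈ I, utt t - Δ (u t) + (b t : ℂ) • ut t = 0) ∧
    u 1 = u₀ ∧ ut 1 = u₁

end WeakDamping

end

/-! At angular frequency `k = 2π|ξ|` the damped equation becomes the ODE `y'' + (2μ/t) y' + k² y =
0`. The substitution `y = t^(-μ) q(tk)` removes the damping and scales the frequency away, leaving
the single equation `q'' + (1 + (μ - μ²)/x²) q = 0`. Its potential is integrable at infinity, so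
there are Jost solutions `p ∼ cos` and `r ∼ sin` with error `O(1/x)`, uniformly on every `[ε, ∞)`
(`exists_jost_solution`, a contraction in a weighted sup norm). Their Wronskian is `1`
(`exists_jost_pair`).

Hence a solution is `t^(-μ) (p(tk) α + r(tk) β)`, where `α`, `β` come from the data at `t = 1` by
Cramer's rule (`jostCoeff`). The free wave is obtained by putting `cos`, `sin` in place of `p`, `r`
with the same coefficients, and `W` reads off its data at `t = 1`. The difference `t^μ u - w` has
Fourier transform `(p - cos)(tk) α + (r - sin)(tk) β`, of size `O(1/(tk))`; a lower bound on `k`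
turns this into `O(1/t)` (`norm_dampedWave_sub_freeWave_le`). The same lower bound makes `α`, `β`
square integrable, since the factor `1/k` in front of the velocity compensates for the weight of
`H⁻¹` (`norm_jostCoeff_le`). Plancherel gives the norm estimates.

The estimate concerns every distributional solution, so uniqueness in `𝓢'` is needed
(`eq_zero_of_weakly_damped`). On the Fourier side the equation only multiplies by the smooth
function `k²`, which keeps the support of a test function inside a fixed ball. Banach--Steinhaus
bounds the solution on `[1, T]` by one Schwartz norm, multiplication by `k²` is bounded in that same
norm on the ball, and integrating the ODE twice against an exponential weight halves the bound each
time. So the solution vanishes on compactly supported test functions, which are dense. -/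

noncomputable section

namespace WeakDamping

open Filter Topology

/-! ### Completeness of the Schwartz space and Banach--Steinhaus -/

section Complete

variable {E F : Type*} [NormedAddCommGroup E] [NormedSpace ℝ E] [NormedAddCommGroup F]
  [NormedSpace ℝ F] [CompleteSpace F]

/-- A series of Schwartz functions that converges absolutely in every seminorm has a Schwartz
function as its pointwise sum. -/
theorem exists_schwartzMap_eq_tsum (f : ℕ → 𝓢(E, F))
    (hf : ∀ k l, Summable fun j => SchwartzMap.seminorm ℝ k l (f j)) :
    ∃ g : 𝓢(E, F), (∀ x, g x = ∑' j, f j x) ∧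
      ∀ k l, SchwartzMap.seminorm ℝ k l g ≤ ∑' j, SchwartzMap.seminorm ℝ k l (f j) := by
  have hb : ∀ (l : ℕ) (j : ℕ) (x : E),
      ‖iteratedFDeriv ℝ l (f j) x‖ ≤ SchwartzMap.seminorm ℝ 0 l (f j) := fun l j x =>
    SchwartzMap.norm_iteratedFDeriv_le_seminorm ℝ (f j) l x
  have hsm : ∀ j, ContDiff ℝ ((⊤ : ℕ∞) : WithTop ℕ∞) (f j) := fun j => (f j).smooth ⊤
  have hcd : ContDiff ℝ ((⊤ : ℕ∞) : WithTop ℕ∞) fun x => ∑' j, f j x :=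
    contDiff_tsum (v := fun l j => SchwartzMap.seminorm ℝ 0 l (f j)) hsm
      (fun k _ => hf 0 k) (fun l j x _ => hb l j x)
  have hder : ∀ (l : ℕ) (x : E), iteratedFDeriv ℝ l (fun x => ∑' j, f j x) x =
      ∑' j, iteratedFDeriv ℝ l (f j) x := fun l x =>
    iteratedFDeriv_tsum_apply (v := fun l j => SchwartzMap.seminorm ℝ 0 l (f j)) hsm
      (fun k _ => hf 0 k) (fun l j x _ => hb l j x) le_top x
  have hdec : ∀ (k l : ℕ) (x : E), ‖x‖ ^ k * ‖iteratedFDeriv ℝ l (fun x => ∑' j, f j x) x‖ ≤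
      ∑' j, SchwartzMap.seminorm ℝ k l (f j) := by
    intro k l x
    have hs : Summable fun j => ‖iteratedFDeriv ℝ l (f j) x‖ :=
      Summable.of_nonneg_of_le (fun _ => norm_nonneg _) (fun j => hb l j x) (hf 0 l)
    rw [hder]
    calc ‖x‖ ^ k * ‖∑' j, iteratedFDeriv ℝ l (f j) x‖
        ≤ ‖x‖ ^ k * ∑' j, ‖iteratedFDeriv ℝ l (f j) x‖ := by
          gcongr
          exact norm_tsum_le_tsum_norm hs
      _ = ∑' j, ‖x‖ ^ k * ‖iteratedFDeriv ℝ l (f j) x‖ := tsum_mul_left.symm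
      _ ≤ _ := (hs.mul_left _).tsum_le_tsum (fun j => SchwartzMap.le_seminorm ℝ k l (f j) x)
          (hf k l)
  refine ⟨⟨fun x => ∑' j, f j x, hcd, fun k l => ⟨_, hdec k l⟩⟩, fun x => rfl, fun k l => ?_⟩
  exact SchwartzMap.seminorm_le_bound ℝ k l _ (tsum_nonneg fun j => apply_nonneg _ _) (hdec k l)

/-- A series of Schwartz functions that converges absolutely in every seminorm converges. -/
theorem exists_tendsto_sum_schwartzMap (f : ℕ → 𝓢(E, F))
    (hf : ∀ k l, Summable fun j => SchwartzMap.seminorm ℝ k l (f j)) :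
    ∃ g : 𝓢(E, F), Tendsto (fun n => ∑ j ∈ Finset.range n, f j) atTop (𝓝 g) := by
  obtain ⟨g, hg, -⟩ := exists_schwartzMap_eq_tsum f hf
  refine ⟨g, ?_⟩
  rw [(schwartz_withSeminorms ℝ E F).tendsto_nhds]
  rintro ⟨k, l⟩ ε hε
  have htail := tendsto_sum_nat_add fun j => SchwartzMap.seminorm ℝ k l (f j)
  filter_upwards [htail.eventually (gt_mem_nhds hε)] with n hn
  obtain ⟨r, hr, hrn⟩ := exists_schwartzMap_eq_tsum (fun j => f (j + n))
    fun k l => (summable_nat_add_iff n).2 (hf k l)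
  have hrg : ∑ j ∈ Finset.range n, f j - g = -r := by
    ext x
    have hsx : Summable fun j => f j x :=
      Summable.of_norm_bounded (hf 0 0) fun j => SchwartzMap.norm_le_seminorm ℝ (f j) x
    have := hsx.sum_add_tsum_nat_add n
    simp [hg, hr, ← this]
  change SchwartzMap.seminorm ℝ k l _ < ε
  rw [hrg, map_neg_eq_map]
  exact (hrn k l).trans_lt hn

/-- The seminorms form a countable family, so it is enough to treat sequences with rapidly
decreasing increments. Such a sequence is the partial sum of its telescoping series, which converges
absolutely in each seminorm. Completeness makes the space Baire and hence barrelled, as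
Banach--Steinhaus requires. -/
instance completeSpace_schwartzMap : CompleteSpace 𝓢(E, F) := by
  have : (uniformity 𝓢(E, F)).IsCountablyGenerated :=
    IsUniformAddGroup.uniformity_countably_generated
  let V : ℕ → Set 𝓢(E, F) := fun N =>
    {f | ∀ i ∈ Finset.Iic (N, N), schwartzSeminormFamily ℝ E F i f < (1 / 2) ^ N}
  have hV : ∀ N, V N ∈ 𝓝 (0 : 𝓢(E, F)) := by
    intro N
    refine (Finset.eventually_all _).2 fun i _ => ?_
    have hc := ((schwartz_withSeminorms ℝ E F).continuous_seminorm i).tendsto 0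
    rw [map_zero] at hc
    exact hc.eventually (gt_mem_nhds (by positivity))
  refine UniformSpace.complete_of_convergent_controlled_sequences
    (fun N => {p | p.2 - p.1 ∈ V N}) (fun N => ?_) fun u hu => ?_
  · rw [uniformity_eq_comap_nhds_zero]
    exact preimage_mem_comap (hV N)
  · have hs : ∀ k l, Summable fun j => SchwartzMap.seminorm ℝ k l (u (j + 1) - u j) := by
      intro k l
      -- `V N` controls only the seminorms with both indices at most `N`, so the seminorm `(k, l)`
      -- is controlled from index `max k l` on.
      refine (summable_nat_add_iff (max k l)).1 ?_
      refine Summable.of_nonneg_of_le (fun _ => apply_nonneg _ _) (fun j => ?_)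
        ((summable_nat_add_iff (max k l)).2 (summable_geometric_two))
      have := hu (j + max k l) (j + max k l) (j + max k l + 1) le_rfl (by lia) (k, l)
        (by simp only [Finset.mem_Iic, Prod.mk_le_mk]; constructor <;> lia)
      exact this.le
    obtain ⟨g, hg⟩ := exists_tendsto_sum_schwartzMap _ hs
    refine ⟨g + u 0, ?_⟩
    simp_rw [Finset.sum_range_sub] at hg
    simpa using hg.add_const (u 0)

/-- Banach--Steinhaus: a pointwise bounded family of tempered distributions is bounded by a
multiple of finitely many Schwartz seminorms. -/
theorem exists_schwartz_bound {ι : Type*} (T : ι → 𝓢'(E, ℂ))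
    (hT : ∀ φ : 𝓢(E, ℂ), ∃ C : ℝ, ∀ i, ‖T i φ‖ ≤ C) :
    ∃ (N : ℕ) (A : ℝ), 0 ≤ A ∧ ∀ i (φ : 𝓢(E, ℂ)),
      ‖T i φ‖ ≤ A * (Finset.Iic (N, N)).sup (schwartzSeminormFamily ℝ E ℂ) φ := by
  have : (uniformity 𝓢(E, ℂ)).IsCountablyGenerated :=
    IsUniformAddGroup.uniformity_countably_generated
  have : BaireSpace 𝓢(E, ℂ) := inferInstance
  have hb : BarrelledSpace ℝ 𝓢(E, ℂ) := BaireSpace.instBarrelledSpace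
  let T' : ι → 𝓢(E, ℂ) →L[ℝ] ℂ := fun i =>
    ContinuousLinearMap.restrictScalars ℝ (T i : 𝓢(E, ℂ) →L[ℂ] ℂ)
  have hq := norm_withSeminorms ℝ ℂ
  have hequi : UniformEquicontinuous ((↑) ∘ T' : ι → 𝓢(E, ℂ) → ℂ) := by
    refine hq.banach_steinhaus fun _ φ => ?_
    obtain ⟨C, hC⟩ := hT φ
    exact ⟨C, by rintro _ ⟨i, rfl⟩; exact hC i⟩
  obtain ⟨p, hp, hTp⟩ := (hq.uniformEquicontinuous_iff_exists_continuous_seminorm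
    fun i => (T' i : 𝓢(E, ℂ) →ₗ[ℝ] ℂ)).1 hequi 0
  obtain ⟨s, C, -, hC⟩ := Seminorm.bound_of_continuous (schwartz_withSeminorms ℝ E ℂ) p hp
  -- The finite index set is enlarged to a square, so that a single `N` describes the norm.
  have hs : s ⊆ Finset.Iic (s.sup fun i => max i.1 i.2, s.sup fun i => max i.1 i.2) := by
    intro i hi
    have h := Finset.le_sup (f := fun i : ℕ × ℕ => max i.1 i.2) hi
    exact Finset.mem_Iic.2 ⟨(le_max_left _ _).trans h, (le_max_right _ _).trans h⟩
  refine ⟨s.sup fun i => max i.1 i.2, C, C.2, fun i φ => (hTp i φ).trans ((hC φ).trans ?_)⟩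
  exact mul_le_mul_of_nonneg_left (Finset.sup_mono (f := schwartzSeminormFamily ℝ E ℂ) hs φ) C.2

end Complete

/-! ### Multiplication and cut-off of Schwartz functions -/

section Cutoff

variable {E : Type*} [NormedAddCommGroup E] [NormedSpace ℝ E]

/-- Multiplication by a smooth function is bounded with respect to a single Schwartz norm on the
functions supported in a fixed compact set. -/
theorem exists_seminorm_smulLeft_le [ProperSpace E] {g : E → ℂ} (hg : g.HasTemperateGrowth) (R : ℝ)
    (N : ℕ) :
    ∃ K : ℝ, 0 ≤ K ∧ ∀ φ : 𝓢(E, ℂ), tsupport φ ⊆ Metric.closedBall 0 R →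
      (Finset.Iic (N, N)).sup (schwartzSeminormFamily ℝ E ℂ) (SchwartzMap.smulLeftCLM ℂ g φ) ≤
        K * (Finset.Iic (N, N)).sup (schwartzSeminormFamily ℝ E ℂ) φ := by
  have hgs : ∀ m : ℕ, ContDiff ℝ m g := fun m => hg.1.of_le (by exact_mod_cast le_top)
  have hB : ∀ i : ℕ, ∃ B : ℝ, ∀ x ∈ Metric.closedBall (0 : E) R, ‖iteratedFDeriv ℝ i g x‖ ≤ B :=
    fun i => (isCompact_closedBall 0 R).exists_bound_of_continuousOn
      ((hgs i).continuous_iteratedFDeriv le_rfl).continuousOn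
  choose B hB using hB
  let P : Seminorm ℝ 𝓢(E, ℂ) := (Finset.Iic (N, N)).sup (schwartzSeminormFamily ℝ E ℂ)
  have hP : ∀ k ≤ N, ∀ l ≤ N, ∀ φ : 𝓢(E, ℂ), SchwartzMap.seminorm ℝ k l φ ≤ P φ :=
    fun k hk l hl φ => Finset.le_sup (f := schwartzSeminormFamily ℝ E ℂ)
      (Finset.mem_Iic.2 (show (k, l) ≤ (N, N) from ⟨hk, hl⟩)) φ
  let K : ℕ → ℝ := fun l => ∑ i ∈ Finset.range (l + 1), (l.choose i : ℝ) * |B i|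
  have hK : ∀ l, 0 ≤ K l := fun l => Finset.sum_nonneg fun i _ => by positivity
  refine ⟨∑ l ∈ Finset.range (N + 1), K l, Finset.sum_nonneg fun l _ => hK l, fun φ hφ => ?_⟩
  have hsum : ∀ l ≤ N, K l ≤ ∑ l ∈ Finset.range (N + 1), K l := fun l hl =>
    Finset.single_le_sum (fun l _ => hK l) (Finset.mem_range.2 (by lia))
  refine Seminorm.finset_sup_apply_le (mul_nonneg (Finset.sum_nonneg fun l _ => hK l)
    (apply_nonneg _ _)) ?_
  rintro ⟨k, l⟩ hkl
  obtain ⟨hk, hl⟩ : k ≤ N ∧ l ≤ N := Finset.mem_Iic.1 hkl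
  refine le_trans (SchwartzMap.seminorm_le_bound ℝ k l _ (mul_nonneg (hK l) (apply_nonneg P φ))
    fun x => ?_) (mul_le_mul_of_nonneg_right (hsum l hl) (apply_nonneg P φ))
  have hfun : ⇑(SchwartzMap.smulLeftCLM ℂ g φ) = fun x => g x * φ x := by
    ext x
    rw [SchwartzMap.smulLeftCLM_apply_apply hg, smul_eq_mul]
  rw [hfun]
  -- Leibniz involves derivatives of `φ` of order at most `l` and leaves the weight `‖x‖ ^ k` alone,
  -- so the same `N` serves on both sides. The iteration in the uniqueness proof depends on this
  -- absence of loss.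
  have hprod := norm_iteratedFDeriv_mul_le (hgs l) (φ.smooth l) x (n := l) le_rfl
  calc ‖x‖ ^ k * ‖iteratedFDeriv ℝ l (fun x => g x * φ x) x‖
      ≤ ‖x‖ ^ k * ∑ i ∈ Finset.range (l + 1),
        (l.choose i : ℝ) * ‖iteratedFDeriv ℝ i g x‖ * ‖iteratedFDeriv ℝ (l - i) φ x‖ := by gcongr
    _ = ∑ i ∈ Finset.range (l + 1), (l.choose i : ℝ) *
        (‖iteratedFDeriv ℝ i g x‖ * (‖x‖ ^ k * ‖iteratedFDeriv ℝ (l - i) φ x‖)) := by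
        rw [Finset.mul_sum]
        exact Finset.sum_congr rfl fun i _ => by ring
    _ ≤ ∑ i ∈ Finset.range (l + 1), (l.choose i : ℝ) * (|B i| * P φ) := by
        refine Finset.sum_le_sum fun i _ => mul_le_mul_of_nonneg_left ?_ (by positivity)
        by_cases hx : x ∈ Metric.closedBall (0 : E) R
        · refine mul_le_mul ((hB i x hx).trans (le_abs_self _)) ?_ (by positivity) (abs_nonneg _)
          exact (SchwartzMap.le_seminorm ℝ k (l - i) φ x).trans (hP k hk _ (by lia) φ)
        · have : iteratedFDeriv ℝ (l - i) φ x = 0 := by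
            by_contra h
            exact hx (hφ (support_iteratedFDeriv_subset (𝕜 := ℝ) (l - i) h))
          rw [this, norm_zero, mul_zero, mul_zero]
          exact mul_nonneg (abs_nonneg _) (apply_nonneg P φ)
    _ = K l * P φ := by
        rw [Finset.sum_mul]
        exact Finset.sum_congr rfl fun i _ => by ring

/-- The factor `‖x‖` in the bound for `g` is paid for by one more power of the weight on `φ`. With
`g` one minus a wide cut-off, `b` is small and the product tends to zero in every seminorm. -/
theorem norm_iteratedFDeriv_mul_schwartz_le {g : E → ℂ} {l : ℕ} (hg : ContDiff ℝ l g)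
    (φ : 𝓢(E, ℂ)) {b : ℕ → ℝ} (hb₀ : ∀ i, 0 ≤ b i)
    (k : ℕ) (x : E) (hb : ∀ i, ‖iteratedFDeriv ℝ i g x‖ ≤ b i * ‖x‖) :
    ‖x‖ ^ k * ‖iteratedFDeriv ℝ l (fun x => g x * φ x) x‖ ≤ ∑ i ∈ Finset.range (l + 1),
      (l.choose i : ℝ) * (b i * SchwartzMap.seminorm ℝ (k + 1) (l - i) φ) := by
  have hprod := norm_iteratedFDeriv_mul_le hg (φ.smooth l) x (n := l) le_rfl
  refine (mul_le_mul_of_nonneg_left hprod (by positivity)).trans ?_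
  rw [Finset.mul_sum]
  refine Finset.sum_le_sum fun i _ => ?_
  have h1 := SchwartzMap.le_seminorm ℝ (k + 1) (l - i) φ x
  have hbi := hb₀ i
  calc ‖x‖ ^ k * ((l.choose i : ℝ) * ‖iteratedFDeriv ℝ i g x‖ * ‖iteratedFDeriv ℝ (l - i) φ x‖)
      ≤ ‖x‖ ^ k * ((l.choose i : ℝ) * (b i * ‖x‖) * ‖iteratedFDeriv ℝ (l - i) φ x‖) := by
        gcongr
        exact hb i
    _ = (l.choose i : ℝ) * (b i * (‖x‖ ^ (k + 1) * ‖iteratedFDeriv ℝ (l - i) φ x‖)) := by ring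
    _ ≤ _ := by gcongr

/-- Compactly supported Schwartz functions approximate every Schwartz function. -/
theorem exists_tendsto_compactlySupported [FiniteDimensional ℝ E] [HasContDiffBump E]
    (φ : 𝓢(E, ℂ)) :
    ∃ ψ : ℕ → 𝓢(E, ℂ), (∀ m, ∃ R : ℝ, tsupport (ψ m) ⊆ Metric.closedBall 0 R) ∧
      Tendsto ψ atTop (𝓝 φ) := by
  let f : ContDiffBump (0 : E) := ⟨1, 2, one_pos, one_lt_two⟩
  let r : ℕ → ℝ := fun m => ((m : ℝ) + 1)⁻¹
  have hr0 : ∀ m, 0 < r m := fun m => by positivity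
  have hr1 : ∀ m, r m ≤ 1 := fun m => inv_le_one_of_one_le₀ (by linarith [m.cast_nonneg (α := ℝ)])
  let g : E → ℂ := fun x => 1 - (f x : ℂ)
  have hg : ContDiff ℝ ((⊤ : ℕ∞) : WithTop ℕ∞) g :=
    contDiff_const.sub (Complex.ofRealCLM.contDiff.comp f.contDiff)
  have hfc : HasCompactSupport fun x => (f x : ℂ) :=
    f.hasCompactSupport.comp_left (g := Complex.ofReal) Complex.ofReal_zero
  have hfs : ContDiff ℝ ((⊤ : ℕ∞) : WithTop ℕ∞) fun x => (f x : ℂ) :=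
    Complex.ofRealCLM.contDiff.comp f.contDiff
  have hgB : ∀ i : ℕ, ∃ B : ℝ, ∀ x, ‖iteratedFDeriv ℝ i g x‖ ≤ B := by
    intro i
    refine ⟨1 + SchwartzMap.seminorm ℝ 0 i (hfc.toSchwartzMap hfs), fun x => ?_⟩
    have h1 : iteratedFDeriv ℝ i g x = iteratedFDeriv ℝ i (fun _ : E => (1 : ℂ)) x -
        iteratedFDeriv ℝ i (fun x => (f x : ℂ)) x :=
      by
      exact iteratedFDeriv_sub_apply (f := fun _ : E => (1 : ℂ)) contDiffAt_const
        (hfs.of_le (by exact_mod_cast le_top)).contDiffAt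
    rw [h1]
    refine (norm_sub_le _ _).trans (add_le_add ?_
      (SchwartzMap.norm_iteratedFDeriv_le_seminorm ℝ (hfc.toSchwartzMap hfs) i x))
    rcases eq_or_ne i 0 with rfl | hi
    · simp
    · simp [iteratedFDeriv_const_of_ne hi]
  choose B hB using hgB
  let χ : ℕ → E → ℂ := fun m x => (f (r m • x) : ℂ)
  have hχc : ∀ m, HasCompactSupport (χ m) := fun m =>
    hfc.comp_homeomorph (Homeomorph.smulOfNeZero (r m) (hr0 m).ne')
  have hχ : ∀ m, ContDiff ℝ ((⊤ : ℕ∞) : WithTop ℕ∞) (χ m) := fun m =>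
    Complex.ofRealCLM.contDiff.comp (f.contDiff.comp (contDiff_const_smul _))
  have hχt : ∀ m, (χ m).HasTemperateGrowth := fun m =>
    ((hχc m).toSchwartzMap (hχ m)).hasTemperateGrowth
  refine ⟨fun m => SchwartzMap.smulLeftCLM ℂ (χ m) φ, fun m => ?_, ?_⟩
  · obtain ⟨R, hR⟩ := (hχc m).isCompact.isBounded.subset_closedBall (0 : E)
    exact ⟨R, (SchwartzMap.tsupport_smulLeftCLM_subset _ _).trans (Set.inter_subset_right.trans hR)⟩
  rw [(schwartz_withSeminorms ℝ E ℂ).tendsto_nhds]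
  rintro ⟨k, l⟩ ε hε
  -- `g` vanishes on the open unit ball, and outside it a factor `‖y‖ ≥ 1` costs nothing. After the
  -- dilation by `r m` this factor supplies the smallness.
  have hg0 : ∀ (i : ℕ) (y : E), ‖iteratedFDeriv ℝ i g y‖ ≤ |B i| * ‖y‖ := by
    intro i y
    rcases lt_or_ge ‖y‖ 1 with hy | hy
    · have h0 : g =ᶠ[𝓝 y] fun _ => 0 := by
        filter_upwards [Metric.isOpen_ball.mem_nhds (mem_ball_zero_iff.2 hy)] with z hz
        simp [g, f.one_of_mem_closedBall (Metric.ball_subset_closedBall hz)]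
      rw [(h0.iteratedFDeriv ℝ i).eq_of_nhds, iteratedFDeriv_fun_zero, Pi.zero_apply, norm_zero]
      positivity
    · exact (hB i y).trans ((le_abs_self _).trans (le_mul_of_one_le_right (abs_nonneg _) hy))
  have hgr : ∀ (m i : ℕ) (x : E), ‖iteratedFDeriv ℝ i (fun x => g (r m • x)) x‖ ≤
      |B i| * (r m * ‖x‖) := by
    intro m i x
    rw [iteratedFDeriv_comp_const_smul (r m) (hg.of_le (by exact_mod_cast le_top)), norm_smul]
    have h1 := hg0 i (r m • x)
    rw [norm_smul, Real.norm_of_nonneg (hr0 m).le] at h1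
    refine le_trans (mul_le_of_le_one_left (norm_nonneg _) ?_) h1
    rw [norm_pow, Real.norm_of_nonneg (hr0 m).le]
    exact pow_le_one₀ (hr0 m).le (hr1 m)
  let K : ℝ := ∑ i ∈ Finset.range (l + 1),
    (l.choose i : ℝ) * (|B i| * SchwartzMap.seminorm ℝ (k + 1) (l - i) φ)
  have hK : 0 ≤ K := Finset.sum_nonneg fun i _ => by positivity
  have hbound : ∀ m, SchwartzMap.seminorm ℝ k l (SchwartzMap.smulLeftCLM ℂ (χ m) φ - φ) ≤
      r m * K := by
    intro m
    refine SchwartzMap.seminorm_le_bound ℝ k l _ (mul_nonneg (hr0 m).le hK) fun x => ?_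
    have hfun : ⇑(SchwartzMap.smulLeftCLM ℂ (χ m) φ - φ) = -fun x => g (r m • x) * φ x := by
      ext x
      simp only [sub_apply, SchwartzMap.smulLeftCLM_apply_apply (hχt m), smul_eq_mul,
        Pi.neg_apply, χ, g]
      ring
    rw [hfun, iteratedFDeriv_neg_apply, norm_neg]
    refine (norm_iteratedFDeriv_mul_schwartz_le ((hg.of_le (by exact_mod_cast le_top)).comp
      (contDiff_const_smul _)) φ (b := fun i => |B i| * r m)
      (fun i => mul_nonneg (abs_nonneg _) (hr0 m).le) k x fun i => ?_).trans (le_of_eq ?_)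
    · exact (hgr m i x).trans_eq (mul_assoc _ _ _).symm
    · rw [Finset.mul_sum]
      exact Finset.sum_congr rfl fun i _ => by ring
  have hlim : Tendsto (fun m => r m * K) atTop (𝓝 0) := by
    have : Tendsto r atTop (𝓝 0) := by
      simpa [r, one_div] using tendsto_one_div_add_atTop_nhds_zero_nat (𝕜 := ℝ)
    simpa using this.mul_const K
  filter_upwards [hlim.eventually (gt_mem_nhds hε)] with m hm
  exact (hbound m).trans_lt hm

end Cutoff

/-! ### Uniqueness for the damped equation in tempered distributions -/

section Uniqueness

/-- If a function with values in `ℂ` vanishes at `1` and its derivative is bounded by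
`M * exp (Λ (t - 1))`, then it is bounded by `M / Λ * exp (Λ (t - 1))`. -/
theorem norm_le_exp_of_deriv {y y' : ℝ → ℂ} {T M Λ : ℝ} (hΛ : 0 < Λ) (hM : 0 ≤ M)
    (hy : ∀ t ∈ Set.Ici (1 : ℝ), HasDerivWithinAt y (y' t) (Set.Ici 1) t) (h1 : y 1 = 0)
    (hb : ∀ t ∈ Set.Icc 1 T, ‖y' t‖ ≤ M * Real.exp (Λ * (t - 1))) :
    ∀ t ∈ Set.Icc 1 T, ‖y t‖ ≤ M / Λ * Real.exp (Λ * (t - 1)) := by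
  have hB : ∀ x : ℝ, HasDerivAt (fun t => M / Λ * Real.exp (Λ * (t - 1)))
      (M * Real.exp (Λ * (x - 1))) x := by
    intro x
    have h := ((((hasDerivAt_id x).sub_const 1).const_mul Λ).exp).const_mul (M / Λ)
    refine h.congr_deriv ?_
    field_simp
    simp
  refine image_norm_le_of_norm_deriv_right_le_deriv_boundary
    (fun t ht => ((hy t ht.1).continuousWithinAt).mono Set.Icc_subset_Ici_self)
    (fun t ht => (hy t ht.1).mono (Set.Ici_subset_Ici.2 ht.1)) ?_ hB
    (fun t ht => hb t (Set.Ico_subset_Icc_self ht))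
  rw [h1, norm_zero]
  positivity

theorem rpow_le_rpow_abs {t T : ℝ} (ht : t ∈ Set.Icc 1 T) (ν : ℝ) : t ^ ν ≤ T ^ |ν| :=
  (Real.rpow_le_rpow_of_exponent_le ht.1 (le_abs_self ν)).trans
    (Real.rpow_le_rpow (by linarith [ht.1]) ht.2 (abs_nonneg ν))

/-- An exponential bound for the weakly damped oscillator with zero initial data. -/
theorem norm_le_of_weakly_damped (μ : ℝ) {T : ℝ} {y y₁ y₂ g : ℝ → ℂ} {G Λ : ℝ} (hΛ : 0 < Λ)
    (hG : 0 ≤ G)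
    (hy : ∀ t ∈ Set.Ici (1 : ℝ), HasDerivWithinAt y (y₁ t) (Set.Ici 1) t)
    (hy₁ : ∀ t ∈ Set.Ici (1 : ℝ), HasDerivWithinAt y₁ (y₂ t) (Set.Ici 1) t)
    (heq : ∀ t ∈ Set.Ici (1 : ℝ), y₂ t + ((2 * μ / t : ℝ) : ℂ) * y₁ t + g t = 0)
    (h0 : y 1 = 0) (h1 : y₁ 1 = 0)
    (hg : ∀ t ∈ Set.Icc 1 T, ‖g t‖ ≤ G * Real.exp (Λ * (t - 1))) :
    ∀ t ∈ Set.Icc 1 T,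
      ‖y t‖ ≤ (T ^ |2 * μ|) ^ 2 * G / Λ ^ 2 * Real.exp (Λ * (t - 1)) := by
  rcases lt_or_ge T 1 with hT | hT
  · exact fun t ht => absurd (ht.1.trans ht.2) (not_le.2 hT)
  have hT0 : 0 ≤ T := by linarith
  set P := T ^ |2 * μ| with hP
  have hP0 : 0 ≤ P := by positivity
  -- The integrating factor `t ^ (2 * μ)` absorbs the damping: the derivative of `t ^ (2 * μ) * y₁`
  -- is `-t ^ (2 * μ) * g`. Two integrations then each gain `1 / Λ`, while inserting and removing
  -- the integrating factor costs `P` each time.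
  have hz : ∀ t ∈ Set.Ici (1 : ℝ), HasDerivWithinAt (fun t => ((t ^ (2 * μ) : ℝ) : ℂ) * y₁ t)
      (-(((t ^ (2 * μ) : ℝ) : ℂ) * g t)) (Set.Ici 1) t := by
    intro t ht
    have ht0 : (0 : ℝ) < t := lt_of_lt_of_le one_pos ht
    have h :=
      (((Real.hasDerivAt_rpow_const (p := 2 * μ) (Or.inl ht0.ne')).ofReal_comp).hasDerivWithinAt
      (s := Set.Ici 1)).mul (hy₁ t ht)
    refine h.congr_deriv ?_
    have e1 : y₂ t = -(((2 * μ / t : ℝ) : ℂ) * y₁ t + g t) := by linear_combination heq t ht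
    rw [e1, Real.rpow_sub_one ht0.ne']
    have : (t : ℂ) ≠ 0 := by exact_mod_cast ht0.ne'
    push_cast
    field_simp
    ring
  have hz' := norm_le_exp_of_deriv (T := T) hΛ (mul_nonneg hP0 hG) hz (by simp [h1]) fun t ht => by
    have ht0 : (0 : ℝ) ≤ t := by linarith [ht.1]
    rw [norm_neg, norm_mul, Complex.norm_real, Real.norm_of_nonneg (by positivity), mul_assoc]
    exact mul_le_mul (rpow_le_rpow_abs ht _) (hg t ht) (norm_nonneg _) hP0
  have hy' := norm_le_exp_of_deriv (T := T) (M := P ^ 2 * G / Λ) hΛ (by positivity) hy h0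
    fun t ht => by
      have ht0 : (0 : ℝ) < t := by linarith [ht.1]
      have e : y₁ t = ((t ^ (-(2 * μ)) : ℝ) : ℂ) * (((t ^ (2 * μ) : ℝ) : ℂ) * y₁ t) := by
        rw [← mul_assoc, ← Complex.ofReal_mul, ← Real.rpow_add ht0]
        simp
      rw [e, norm_mul, Complex.norm_real, Real.norm_of_nonneg (by positivity)]
      have hr : t ^ (-(2 * μ)) ≤ P := by
        have := rpow_le_rpow_abs ht (-(2 * μ))
        rwa [abs_neg] at this
      refine (mul_le_mul hr (hz' t ht) (norm_nonneg _) hP0).trans_eq ?_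
      ring
  intro t ht
  refine (hy' t ht).trans_eq ?_
  field_simp

variable {E : Type*} [NormedAddCommGroup E] [NormedSpace ℝ E] [FiniteDimensional ℝ E]

/-- The weakly damped oscillator equation in the space of tempered distributions, with a smooth
multiplier as the frequency squared, has only the zero solution for zero initial data. -/
theorem eq_zero_of_weakly_damped [HasContDiffBump E] {g : E → ℂ} (hg : g.HasTemperateGrowth)
    (μ : ℝ) {D D₁ D₂ : ℝ → 𝓢'(E, ℂ)}
    (hD : ∀ φ : 𝓢(E, ℂ), ∀ t ∈ Set.Ici (1 : ℝ),
      HasDerivWithinAt (fun s => D s φ) (D₁ t φ) (Set.Ici 1) t)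
    (hD₁ : ∀ φ : 𝓢(E, ℂ), ∀ t ∈ Set.Ici (1 : ℝ),
      HasDerivWithinAt (fun s => D₁ s φ) (D₂ t φ) (Set.Ici 1) t)
    (heq : ∀ φ : 𝓢(E, ℂ), ∀ t ∈ Set.Ici (1 : ℝ),
      D₂ t φ + ((2 * μ / t : ℝ) : ℂ) * D₁ t φ + D t (SchwartzMap.smulLeftCLM ℂ g φ) = 0)
    (h0 : D 1 = 0) (h1 : D₁ 1 = 0) : ∀ t ∈ Set.Ici (1 : ℝ), D t = 0 := by
  intro T hT
  have hcpt : ∀ (R : ℝ) (φ : 𝓢(E, ℂ)), tsupport φ ⊆ Metric.closedBall 0 R → D T φ = 0 := by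
    intro R φ hφ
    -- Each pairing is continuous on the compact interval `[1, T]`, hence bounded there, and
    -- Banach--Steinhaus yields a Schwartz norm independent of `t`.
    obtain ⟨N, A, hA, hbd⟩ := exists_schwartz_bound (fun i : Set.Icc 1 T => D i) fun φ => by
      obtain ⟨C, hC⟩ := isCompact_Icc.exists_bound_of_continuousOn (s := Set.Icc 1 T)
        (f := fun s => D s φ)
        fun t ht => ((hD φ t ht.1).continuousWithinAt).mono Set.Icc_subset_Ici_self
      exact ⟨C, fun i => hC i i.2⟩
    have := FiniteDimensional.proper ℝ E
    obtain ⟨K, hK, hgK⟩ := exists_seminorm_smulLeft_le hg R N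
    set p := (Finset.Iic (N, N)).sup (schwartzSeminormFamily ℝ E ℂ) with hp
    have hT0 : (0 : ℝ) ≤ T := zero_le_one.trans hT
    set L : ℝ := (T ^ |2 * μ|) ^ 2 with hL
    have hL0 : 0 ≤ L := by positivity
    -- Since `Λ ≥ 1`, also `Λ ^ 2 ≥ Λ ≥ 2 * L * K`, so one pass through the equation contracts by `1
    -- / 2`.
    set Λ : ℝ := 2 * L * K + 1 with hΛ
    have hΛ1 : 1 ≤ Λ := by
      rw [hΛ]
      have : 0 ≤ 2 * L * K := by positivity
      linarith
    have hq : L * K / Λ ^ 2 ≤ 1 / 2 := by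
      rw [div_le_iff₀ (by positivity)]
      nlinarith
    -- The induction runs over all test functions supported in the ball at once, because the
    -- hypothesis is applied to `g φ`, which has its support in the same ball.
    have hind : ∀ (m : ℕ) (φ : 𝓢(E, ℂ)), tsupport φ ⊆ Metric.closedBall 0 R →
        ∀ t ∈ Set.Icc 1 T, ‖D t φ‖ ≤ A * (1 / 2) ^ m * p φ * Real.exp (Λ * (t - 1)) := by
      intro m
      induction m with
      | zero =>
        intro φ _ t ht
        rw [pow_zero, mul_one]
        refine (hbd ⟨t, ht⟩ φ).trans (le_mul_of_one_le_right (by positivity) ?_)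
        exact Real.one_le_exp (mul_nonneg (by linarith) (by linarith [ht.1]))
      | succ m ih =>
        intro φ hφ t ht
        have hMφ : tsupport (SchwartzMap.smulLeftCLM ℂ g φ) ⊆ Metric.closedBall 0 R :=
          (SchwartzMap.tsupport_smulLeftCLM_subset _ _).trans (Set.inter_subset_left.trans hφ)
        have h := norm_le_of_weakly_damped μ (T := T) (G := A * (1 / 2) ^ m * (K * p φ))
          (Λ := Λ) (by linarith) (by positivity) (hD φ) (hD₁ φ) (heq φ) (by simp [h0])
          (by simp [h1])
          (fun s hs => (ih _ hMφ s hs).trans (by gcongr; exact hgK φ hφ)) t ht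
        refine h.trans ?_
        rw [← hL]
        calc L * (A * (1 / 2) ^ m * (K * p φ)) / Λ ^ 2 * Real.exp (Λ * (t - 1))
            = (L * K / Λ ^ 2) * (A * (1 / 2) ^ m * p φ * Real.exp (Λ * (t - 1))) := by ring
          _ ≤ (1 / 2) * (A * (1 / 2) ^ m * p φ * Real.exp (Λ * (t - 1))) := by gcongr
          _ = _ := by ring
    have hlim : Tendsto (fun m : ℕ => A * (1 / 2) ^ m * p φ * Real.exp (Λ * (T - 1))) atTop
        (𝓝 0) := by
      have := (((tendsto_pow_atTop_nhds_zero_of_lt_one (r := (1 / 2 : ℝ)) (by norm_num)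
        (by norm_num)).const_mul A).mul_const (p φ)).mul_const (Real.exp (Λ * (T - 1)))
      simpa using this
    exact norm_le_zero_iff.1 (ge_of_tendsto' hlim fun m => hind m φ hφ T ⟨hT, le_rfl⟩)
  ext φ
  obtain ⟨ψ, hψ, hlim⟩ := exists_tendsto_compactlySupported φ
  have hc : Tendsto (fun m => D T (ψ m)) atTop (𝓝 (D T φ)) :=
    ((D T).continuous.tendsto φ).comp hlim
  have hz : ∀ m, D T (ψ m) = 0 := fun m => by
    obtain ⟨R, hR⟩ := hψ m
    exact hcpt R _ hR
  simp_rw [hz] at hc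
  simpa using tendsto_nhds_unique hc tendsto_const_nhds

end Uniqueness

/-! ### Jost solutions of the rescaled oscillator equation -/

section Jost

/-- The perturbation `∫ₓ^∞ sin (s - x) q (1 / s) s⁻² ds` of a free oscillation, in the variable
`y = 1 / s`. -/
def jostTail (q : ℝ → ℝ) (x : ℝ) : ℝ :=
  Real.cos x * (∫ y in (0)..x⁻¹, Real.sin y⁻¹ * q y) -
    Real.sin x * ∫ y in (0)..x⁻¹, Real.cos y⁻¹ * q y

/-- The derivative of `jostTail`. -/
def jostTailDeriv (q : ℝ → ℝ) (x : ℝ) : ℝ :=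
  -Real.sin x * (∫ y in (0)..x⁻¹, Real.sin y⁻¹ * q y) -
    Real.cos x * ∫ y in (0)..x⁻¹, Real.cos y⁻¹ * q y

variable {q : ℝ → ℝ} {M K : ℝ}

theorem intervalIntegrable_mul_of_exp_bound (hq : Measurable q)
    (hb : ∀ y, |q y| ≤ M * Real.exp (K * y)) {k : ℝ → ℝ} (hk : Measurable k)
    (hk1 : ∀ y, |k y| ≤ 1) (a b : ℝ) : IntervalIntegrable (fun y => k y * q y) volume a b := by
  have hc : Continuous fun y => M * Real.exp (K * y) := by fun_prop
  refine (hc.intervalIntegrable a b).mono_fun' (hk.mul hq).aestronglyMeasurable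
    (ae_of_all _ fun y => ?_)
  change |k y * q y| ≤ _
  rw [abs_mul]
  exact (mul_le_of_le_one_left (abs_nonneg _) (hk1 y)).trans (hb y)

theorem measurable_sin_inv : Measurable fun y : ℝ => Real.sin y⁻¹ :=
  Real.measurable_sin.comp measurable_inv

theorem measurable_cos_inv : Measurable fun y : ℝ => Real.cos y⁻¹ :=
  Real.measurable_cos.comp measurable_inv

theorem intervalIntegrable_sin_inv_mul (hq : Measurable q)
    (hb : ∀ y, |q y| ≤ M * Real.exp (K * y)) (a b : ℝ) :
    IntervalIntegrable (fun y => Real.sin y⁻¹ * q y) volume a b :=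
  intervalIntegrable_mul_of_exp_bound hq hb measurable_sin_inv
    (fun _ => Real.abs_sin_le_one _) a b

theorem intervalIntegrable_cos_inv_mul (hq : Measurable q)
    (hb : ∀ y, |q y| ≤ M * Real.exp (K * y)) (a b : ℝ) :
    IntervalIntegrable (fun y => Real.cos y⁻¹ * q y) volume a b :=
  intervalIntegrable_mul_of_exp_bound hq hb measurable_cos_inv
    (fun _ => Real.abs_cos_le_one _) a b

/-- For `(u, v) = (cos x, -sin x)` or `(-sin x, -cos x)` the addition formulas merge both integrals
into one whose kernel is a sine or cosine of a difference. Bounding the integrals separately would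
lose a factor. -/
theorem abs_combination_integral_le (hq : Measurable q)
    (hb : ∀ y, |q y| ≤ M * Real.exp (K * y)) (hK : 0 < K) {u v : ℝ}
    (huv : ∀ θ, |u * Real.sin θ + v * Real.cos θ| ≤ 1) {Y : ℝ} (hY : 0 ≤ Y) :
    |u * (∫ y in (0)..Y, Real.sin y⁻¹ * q y) + v * ∫ y in (0)..Y, Real.cos y⁻¹ * q y| ≤
      M * ((Real.exp (K * Y) - 1) / K) := by
  rw [← intervalIntegral.integral_const_mul, ← intervalIntegral.integral_const_mul,
    ← intervalIntegral.integral_add ((intervalIntegrable_sin_inv_mul hq hb 0 Y).const_mul u)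
      ((intervalIntegrable_cos_inv_mul hq hb 0 Y).const_mul v)]
  have hint : ∫ y in (0)..Y, M * Real.exp (K * y) = M * ((Real.exp (K * Y) - 1) / K) := by
    rw [intervalIntegral.integral_const_mul,
      intervalIntegral.integral_comp_mul_left Real.exp hK.ne']
    simp [div_eq_inv_mul]
  rw [← hint, ← Real.norm_eq_abs]
  refine intervalIntegral.norm_integral_le_of_norm_le hY (ae_of_all _ fun y _ => ?_)
    (Continuous.intervalIntegrable (by fun_prop) _ _)
  have e : u * (Real.sin y⁻¹ * q y) + v * (Real.cos y⁻¹ * q y) =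
      (u * Real.sin y⁻¹ + v * Real.cos y⁻¹) * q y := by ring
  rw [e, norm_mul, Real.norm_eq_abs, Real.norm_eq_abs]
  exact (mul_le_of_le_one_left (abs_nonneg _) (huv _)).trans (hb y)

theorem abs_jostTail_le (hq : Measurable q) (hb : ∀ y, |q y| ≤ M * Real.exp (K * y)) (hK : 0 < K)
    {x : ℝ} (hx : 0 < x) : |jostTail q x| ≤ M * ((Real.exp (K * x⁻¹) - 1) / K) := by
  have h := abs_combination_integral_le hq hb hK (u := Real.cos x) (v := -Real.sin x)
    (fun θ => by
      have e : Real.cos x * Real.sin θ + -Real.sin x * Real.cos θ = Real.sin (θ - x) := by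
        rw [Real.sin_sub]; ring
      rw [e]
      exact Real.abs_sin_le_one _) (inv_nonneg.2 hx.le)
  rwa [neg_mul, ← sub_eq_add_neg] at h

theorem abs_jostTailDeriv_le (hq : Measurable q) (hb : ∀ y, |q y| ≤ M * Real.exp (K * y))
    (hK : 0 < K) {x : ℝ} (hx : 0 < x) :
    |jostTailDeriv q x| ≤ M * ((Real.exp (K * x⁻¹) - 1) / K) := by
  have h := abs_combination_integral_le hq hb hK (u := -Real.sin x) (v := -Real.cos x)
    (fun θ => by
      have e : -Real.sin x * Real.sin θ + -Real.cos x * Real.cos θ = -Real.cos (θ - x) := by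
        rw [Real.cos_sub]; ring
      rw [e, abs_neg]
      exact Real.abs_cos_le_one _) (inv_nonneg.2 hx.le)
  rwa [neg_mul (Real.cos x), ← sub_eq_add_neg] at h

theorem hasDerivAt_integral_inv {k : ℝ → ℝ}
    (hi : ∀ a b, IntervalIntegrable k volume a b) (hm : Measurable k) {x : ℝ} (hx : 0 < x)
    (hc : ContinuousAt k x⁻¹) :
    HasDerivAt (fun x => ∫ y in (0)..x⁻¹, k y) (-(k x⁻¹ / x ^ 2)) x := by
  have h := (intervalIntegral.integral_hasDerivAt_right (hi 0 x⁻¹)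
    (hm.stronglyMeasurable.stronglyMeasurableAtFilter) hc).comp x (hasDerivAt_inv hx.ne')
  refine h.congr_deriv ?_
  ring

theorem continuousAt_inv_of_pos {x : ℝ} (hx : 0 < x) : ContinuousAt (fun y : ℝ => y⁻¹) x⁻¹ :=
  continuousAt_inv₀ (inv_pos.2 hx).ne'

theorem hasDerivAt_integral_sin_inv (hq : Measurable q) (hb : ∀ y, |q y| ≤ M * Real.exp (K * y))
    (hqc : ContinuousOn q (Set.Ioi 0)) {x : ℝ} (hx : 0 < x) :
    HasDerivAt (fun x => ∫ y in (0)..x⁻¹, Real.sin y⁻¹ * q y)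
      (-(Real.sin x * q x⁻¹ / x ^ 2)) x := by
  have h := hasDerivAt_integral_inv (intervalIntegrable_sin_inv_mul hq hb)
    (measurable_sin_inv.mul hq) hx
    ((Real.continuous_sin.continuousAt.comp (continuousAt_inv_of_pos hx)).mul
      (hqc.continuousAt (Ioi_mem_nhds (inv_pos.2 hx))))
  simpa using h

theorem hasDerivAt_integral_cos_inv (hq : Measurable q) (hb : ∀ y, |q y| ≤ M * Real.exp (K * y))
    (hqc : ContinuousOn q (Set.Ioi 0)) {x : ℝ} (hx : 0 < x) :
    HasDerivAt (fun x => ∫ y in (0)..x⁻¹, Real.cos y⁻¹ * q y)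
      (-(Real.cos x * q x⁻¹ / x ^ 2)) x := by
  have h := hasDerivAt_integral_inv (intervalIntegrable_cos_inv_mul hq hb)
    (measurable_cos_inv.mul hq) hx
    ((Real.continuous_cos.continuousAt.comp (continuousAt_inv_of_pos hx)).mul
      (hqc.continuousAt (Ioi_mem_nhds (inv_pos.2 hx))))
  simpa using h

/-- The boundary terms `∓ sin x * cos x * q x⁻¹ / x ^ 2` from the two primitives cancel, as always
in variation of constants. -/
theorem hasDerivAt_jostTail (hq : Measurable q) (hb : ∀ y, |q y| ≤ M * Real.exp (K * y))
    (hqc : ContinuousOn q (Set.Ioi 0)) {x : ℝ} (hx : 0 < x) :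
    HasDerivAt (jostTail q) (jostTailDeriv q x) x := by
  have h := ((Real.hasDerivAt_cos x).mul (hasDerivAt_integral_sin_inv hq hb hqc hx)).sub
    ((Real.hasDerivAt_sin x).mul (hasDerivAt_integral_cos_inv hq hb hqc hx))
  refine h.congr_deriv ?_
  rw [jostTailDeriv]
  ring

/-- Here the boundary terms add up through `sin² + cos² = 1`, so that `jostTail q` solves the
oscillator equation with source `q x⁻¹ / x ^ 2`. -/
theorem hasDerivAt_jostTailDeriv (hq : Measurable q) (hb : ∀ y, |q y| ≤ M * Real.exp (K * y))
    (hqc : ContinuousOn q (Set.Ioi 0)) {x : ℝ} (hx : 0 < x) :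
    HasDerivAt (jostTailDeriv q) (-jostTail q x + q x⁻¹ / x ^ 2) x := by
  have h := ((Real.hasDerivAt_sin x).neg.mul (hasDerivAt_integral_sin_inv hq hb hqc hx)).sub
    ((Real.hasDerivAt_cos x).mul (hasDerivAt_integral_cos_inv hq hb hqc hx))
  refine h.congr_deriv ?_
  rw [jostTail]
  simp only [Pi.neg_apply]
  linear_combination q x⁻¹ / x ^ 2 * Real.sin_sq_add_cos_sq x

theorem measurable_integral_sin_inv (hq : Measurable q) (hb : ∀ y, |q y| ≤ M * Real.exp (K * y)) :
    Measurable fun x : ℝ => ∫ y in (0)..x⁻¹, Real.sin y⁻¹ * q y :=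
  (intervalIntegral.continuous_primitive
    (intervalIntegrable_sin_inv_mul hq hb) 0).measurable.comp measurable_inv

theorem measurable_integral_cos_inv (hq : Measurable q) (hb : ∀ y, |q y| ≤ M * Real.exp (K * y)) :
    Measurable fun x : ℝ => ∫ y in (0)..x⁻¹, Real.cos y⁻¹ * q y :=
  (intervalIntegral.continuous_primitive
    (intervalIntegrable_cos_inv_mul hq hb) 0).measurable.comp measurable_inv

theorem measurable_jostTail (hq : Measurable q) (hb : ∀ y, |q y| ≤ M * Real.exp (K * y)) :
    Measurable (jostTail q) :=
  (Real.measurable_cos.mul (measurable_integral_sin_inv hq hb)).sub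
    (Real.measurable_sin.mul (measurable_integral_cos_inv hq hb))

theorem measurable_jostTailDeriv (hq : Measurable q) (hb : ∀ y, |q y| ≤ M * Real.exp (K * y)) :
    Measurable (jostTailDeriv q) :=
  (Real.measurable_sin.neg.mul (measurable_integral_sin_inv hq hb)).sub
    (Real.measurable_cos.mul (measurable_integral_cos_inv hq hb))

theorem jostTail_sub {q₁ q₂ : ℝ → ℝ} {M₁ M₂ : ℝ} (hq₁ : Measurable q₁)
    (hb₁ : ∀ y, |q₁ y| ≤ M₁ * Real.exp (K * y)) (hq₂ : Measurable q₂)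
    (hb₂ : ∀ y, |q₂ y| ≤ M₂ * Real.exp (K * y)) (x : ℝ) :
    jostTail (q₁ - q₂) x = jostTail q₁ x - jostTail q₂ x := by
  simp only [jostTail, Pi.sub_apply, mul_sub]
  rw [intervalIntegral.integral_sub (intervalIntegrable_sin_inv_mul hq₁ hb₁ _ _)
      (intervalIntegrable_sin_inv_mul hq₂ hb₂ _ _),
    intervalIntegral.integral_sub (intervalIntegrable_cos_inv_mul hq₁ hb₁ _ _)
      (intervalIntegrable_cos_inv_mul hq₂ hb₂ _ _)]
  ring

open BoundedContinuousFunction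

/-- The source term of the Jost integral equation, for an unknown with weight `exp (K / x)`. -/
def jostSource (c K : ℝ) (f : ℝ →ᵇ ℝ) (y : ℝ) : ℝ := c * Real.exp (K * y) * f (Real.log y)

theorem measurable_jostSource (c K : ℝ) (f : ℝ →ᵇ ℝ) : Measurable (jostSource c K f) :=
  (by fun_prop : Measurable fun y : ℝ => c * Real.exp (K * y)).mul
    (f.continuous.measurable.comp Real.measurable_log)

theorem abs_jostSource_le (c K : ℝ) (f : ℝ →ᵇ ℝ) (y : ℝ) :
    |jostSource c K f y| ≤ |c| * ‖f‖ * Real.exp (K * y) := by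
  rw [jostSource, abs_mul, abs_mul, Real.abs_exp]
  have := f.norm_coe_le_norm (Real.log y)
  rw [Real.norm_eq_abs] at this
  calc |c| * Real.exp (K * y) * |f (Real.log y)| ≤ |c| * Real.exp (K * y) * ‖f‖ := by gcongr
    _ = _ := by ring

theorem continuousOn_jostSource (c K : ℝ) (f : ℝ →ᵇ ℝ) :
    ContinuousOn (jostSource c K f) (Set.Ioi 0) :=
  (by fun_prop : Continuous fun y : ℝ => c * Real.exp (K * y)).continuousOn.mul
    (f.continuous.comp_continuousOn (Real.continuousOn_log.mono fun _ hy => ne_of_gt hy))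

/-- Integrating `exp (K * y)` gains `1 / K`, so a weight with large `K` makes the perturbation small
on the whole half-line, however large `c` is. With `τ = log y = -log x` the half-line becomes `ℝ`,
and the unknown is a bounded continuous function there. -/
theorem abs_exp_mul_jostTail_le {c K : ℝ} (hK : 0 < K) (f : ℝ →ᵇ ℝ) (τ : ℝ) :
    |Real.exp (-(K * Real.exp τ)) * jostTail (jostSource c K f) (Real.exp (-τ))| ≤
      |c| / K * ‖f‖ := by
  have h := abs_jostTail_le (measurable_jostSource c K f) (abs_jostSource_le c K f) hK
    (Real.exp_pos (-τ))
  rw [← Real.exp_neg, neg_neg] at h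
  rw [abs_mul, Real.abs_exp]
  calc Real.exp (-(K * Real.exp τ)) * |jostTail (jostSource c K f) (Real.exp (-τ))|
      ≤ Real.exp (-(K * Real.exp τ)) *
        (|c| * ‖f‖ * ((Real.exp (K * Real.exp τ) - 1) / K)) := by gcongr
    _ ≤ Real.exp (-(K * Real.exp τ)) * (|c| * ‖f‖ * (Real.exp (K * Real.exp τ) / K)) := by
        gcongr
        linarith
    _ = |c| / K * ‖f‖ * (Real.exp (-(K * Real.exp τ)) * Real.exp (K * Real.exp τ)) := by ring
    _ = _ := by rw [← Real.exp_add]; simp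

/-- The integral operator whose fixed point is the weighted Jost solution. -/
def jostOperator (a b c : ℝ) {K : ℝ} (hK : 0 < K) (f : ℝ →ᵇ ℝ) : ℝ →ᵇ ℝ :=
  BoundedContinuousFunction.ofNormedAddCommGroup
    (fun τ => Real.exp (-(K * Real.exp τ)) *
      (a * Real.cos (Real.exp (-τ)) + b * Real.sin (Real.exp (-τ)) -
        jostTail (jostSource c K f) (Real.exp (-τ))))
    (by
      have hP : Continuous fun τ => jostTail (jostSource c K f) (Real.exp (-τ)) :=
        continuous_iff_continuousAt.2 fun τ =>
          ContinuousAt.comp (f := fun τ => Real.exp (-τ))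
            (hasDerivAt_jostTail (measurable_jostSource c K f) (abs_jostSource_le c K f)
              (continuousOn_jostSource c K f) (Real.exp_pos _)).continuousAt
            (by fun_prop)
      fun_prop)
    (|a| + |b| + |c| / K * ‖f‖)
    (by
      intro τ
      rw [mul_sub, Real.norm_eq_abs]
      refine (abs_sub _ _).trans (add_le_add ?_ (abs_exp_mul_jostTail_le hK f τ))
      rw [abs_mul, Real.abs_exp]
      refine (mul_le_of_le_one_left (abs_nonneg _) (Real.exp_le_one_iff.2 ?_)).trans
        ((abs_add_le _ _).trans (add_le_add ?_ ?_))
      · have := Real.exp_pos τ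
        nlinarith
      · rw [abs_mul]
        exact mul_le_of_le_one_right (abs_nonneg _) (Real.abs_cos_le_one _)
      · rw [abs_mul]
        exact mul_le_of_le_one_right (abs_nonneg _) (Real.abs_sin_le_one _))

theorem jostOperator_apply (a b c : ℝ) {K : ℝ} (hK : 0 < K) (f : ℝ →ᵇ ℝ) (τ : ℝ) :
    jostOperator a b c hK f τ = Real.exp (-(K * Real.exp τ)) *
      (a * Real.cos (Real.exp (-τ)) + b * Real.sin (Real.exp (-τ)) -
        jostTail (jostSource c K f) (Real.exp (-τ))) := rfl

/-- The free part cancels in a difference, and what remains is linear in `f - g` with norm at most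
`|c| / K`. -/
theorem contractingWith_jostOperator (a b c : ℝ) {K : ℝ} (hK : 0 < K) (hcK : |c| / K ≤ 1 / 2) :
    ContractingWith (1 / 2) (jostOperator a b c hK) := by
  refine ⟨by norm_num [← NNReal.coe_lt_coe], LipschitzWith.of_dist_le_mul fun f g => ?_⟩
  rw [dist_eq_norm, dist_eq_norm]
  refine (BoundedContinuousFunction.norm_le (by positivity)).2 fun τ => ?_
  have hsub : jostSource c K (g - f) = jostSource c K g - jostSource c K f := by
    ext y
    simp only [jostSource, Pi.sub_apply, BoundedContinuousFunction.sub_apply]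
    ring
  have h := abs_exp_mul_jostTail_le (c := c) hK (g - f) τ
  rw [hsub, jostTail_sub (measurable_jostSource c K g) (abs_jostSource_le c K g)
    (measurable_jostSource c K f) (abs_jostSource_le c K f)] at h
  rw [BoundedContinuousFunction.sub_apply, jostOperator_apply, jostOperator_apply, ← mul_sub,
    sub_sub_sub_cancel_left, Real.norm_eq_abs, norm_sub_rev f g]
  refine h.trans (mul_le_mul_of_nonneg_right (hcK.trans_eq ?_) (norm_nonneg _))
  norm_num

/-- For every free oscillation there is a solution of `h'' + (1 + c / x ^ 2) h = 0` on `(0, ∞)`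
that is asymptotic to it. -/
theorem exists_jost_solution (a b c : ℝ) :
    ∃ h h' : ℝ → ℝ, Measurable h ∧ Measurable h' ∧ (∀ x, 0 < x → HasDerivAt h (h' x) x) ∧
      (∀ x, 0 < x → HasDerivAt h' (-((1 + c / x ^ 2) * h x)) x) ∧
      ∀ ε, 0 < ε → ∃ C, 0 ≤ C ∧ ∀ x, ε ≤ x →
        |h x - (a * Real.cos x + b * Real.sin x)| ≤ C / x ∧
        |h' x - (b * Real.cos x - a * Real.sin x)| ≤ C / x := by
  have hK : 0 < 2 * |c| + 1 := by positivity
  set K := 2 * |c| + 1 with hKdef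
  have hcK : |c| / K ≤ 1 / 2 := by
    rw [div_le_iff₀ hK]
    linarith
  set f := (contractingWith_jostOperator a b c hK hcK).fixedPoint with hf
  have hfix : jostOperator a b c hK f = f :=
    (contractingWith_jostOperator a b c hK hcK).fixedPoint_isFixedPt
  have hm := measurable_jostSource c K f
  have hb := abs_jostSource_le c K f
  have hcont := continuousOn_jostSource c K f
  set q := jostSource c K f with hq
  -- The fixed point equation at `τ = log x⁻¹`, with the weight removed, says that the source at
  -- `x⁻¹` is `c` times the solution at `x`.
  have hqh : ∀ x, 0 < x → q x⁻¹ = c * (a * Real.cos x + b * Real.sin x - jostTail q x) := by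
    intro x hx
    have h1 := jostOperator_apply a b c hK f (Real.log x⁻¹)
    rw [hfix, Real.exp_log (inv_pos.2 hx), Real.log_inv, neg_neg, Real.exp_log hx, ← hq] at h1
    rw [hq, jostSource, Real.log_inv, h1, ← hq]
    calc _ = c * (a * Real.cos x + b * Real.sin x - jostTail q x) *
          (Real.exp (K * x⁻¹) * Real.exp (-(K * x⁻¹))) := by ring
      _ = _ := by rw [← Real.exp_add]; simp
  refine ⟨fun x => a * Real.cos x + b * Real.sin x - jostTail q x,
    fun x => b * Real.cos x - a * Real.sin x - jostTailDeriv q x,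
    (by fun_prop : Measurable fun x => a * Real.cos x + b * Real.sin x).sub
      (measurable_jostTail hm hb),
    (by fun_prop : Measurable fun x => b * Real.cos x - a * Real.sin x).sub
      (measurable_jostTailDeriv hm hb), fun x hx => ?_, fun x hx => ?_,
    fun ε hε => ?_⟩
  · refine ((((Real.hasDerivAt_cos x).const_mul a).add ((Real.hasDerivAt_sin x).const_mul b)).sub
      (hasDerivAt_jostTail hm hb hcont hx)).congr_deriv ?_
    ring
  · refine ((((Real.hasDerivAt_cos x).const_mul b).sub ((Real.hasDerivAt_sin x).const_mul a)).sub
      (hasDerivAt_jostTailDeriv hm hb hcont hx)).congr_deriv ?_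
    rw [hqh x hx]
    ring
  · have hexp : ∀ x, ε ≤ x → |c| * ‖f‖ * ((Real.exp (K * x⁻¹) - 1) / K) ≤
        |c| * ‖f‖ * Real.exp (K * ε⁻¹) / x := by
      intro x hx
      have hx0 := hε.trans_le hx
      -- This is `1 - s ≤ exp (-s)` multiplied by `exp s`, with `s = K * x⁻¹`. It extracts the decay
      -- `1 / x`; on `[ε, ∞)` the remaining exponential is at most `exp (K * ε⁻¹)`.
      have h1 : Real.exp (K * x⁻¹) - 1 ≤ K * x⁻¹ * Real.exp (K * x⁻¹) := by
        have := Real.add_one_le_exp (-(K * x⁻¹))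
        have h2 := mul_le_mul_of_nonneg_right this (Real.exp_pos (K * x⁻¹)).le
        rw [← Real.exp_add, neg_add_cancel, Real.exp_zero] at h2
        linarith
      have h3 : Real.exp (K * x⁻¹) ≤ Real.exp (K * ε⁻¹) := by gcongr
      calc |c| * ‖f‖ * ((Real.exp (K * x⁻¹) - 1) / K)
          ≤ |c| * ‖f‖ * ((K * x⁻¹ * Real.exp (K * ε⁻¹)) / K) := by
            gcongr
            exact h1.trans (by gcongr)
        _ = _ := by field_simp
    refine ⟨|c| * ‖f‖ * Real.exp (K * ε⁻¹), by positivity, fun x hx => ⟨?_, ?_⟩⟩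
    · rw [sub_sub_cancel_left, abs_neg]
      exact (abs_jostTail_le hm hb hK (hε.trans_le hx)).trans (hexp x hx)
    · rw [sub_sub_cancel_left, abs_neg]
      exact (abs_jostTailDeriv_le hm hb hK (hε.trans_le hx)).trans (hexp x hx)

/-- The Jost solutions asymptotic to `cos` and `sin`, with their Wronskian. -/
theorem exists_jost_pair (c : ℝ) :
    ∃ p p' r r' : ℝ → ℝ, (Measurable p ∧ Measurable p' ∧ Measurable r ∧ Measurable r') ∧
      (∀ x, 0 < x → HasDerivAt p (p' x) x) ∧
      (∀ x, 0 < x → HasDerivAt p' (-((1 + c / x ^ 2) * p x)) x) ∧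
      (∀ x, 0 < x → HasDerivAt r (r' x) x) ∧
      (∀ x, 0 < x → HasDerivAt r' (-((1 + c / x ^ 2) * r x)) x) ∧
      (∀ x, 0 < x → p x * r' x - p' x * r x = 1) ∧
      ∀ ε, 0 < ε → ∃ C, 1 ≤ C ∧ ∀ x, ε ≤ x →
        |p x - Real.cos x| ≤ C / x ∧ |r x - Real.sin x| ≤ C / x ∧
        |p x| ≤ C ∧ |p' x| ≤ C ∧ |r x| ≤ C ∧ |r' x| ≤ C := by
  obtain ⟨p, p', hpm, hpm', hp, hp', hpb⟩ := exists_jost_solution 1 0 c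
  obtain ⟨r, r', hrm, hrm', hr, hr', hrb⟩ := exists_jost_solution 0 1 c
  simp only [one_mul, zero_mul, add_zero, zero_add, zero_sub, sub_zero] at hpb hrb
  refine ⟨p, p', r, r', ⟨hpm, hpm', hrm, hrm'⟩, hp, hp', hr, hr', ?_, ?_⟩
  -- The equation has no first-order term, so the Wronskian is constant. Its value is the limit at
  -- infinity, where the asymptotics give `cos² + sin² = 1`; all error terms are at most a constant
  -- over `y` for `y ≥ 1`.
  · have hw : ∀ x, 0 < x → HasDerivAt (fun x => p x * r' x - p' x * r x) 0 x := fun x hx =>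
      (((hp x hx).mul (hr' x hx)).sub ((hp' x hx).mul (hr x hx))).congr_deriv (by ring)
    have hconst : ∀ x, 0 < x → ∀ y, 0 < y → p x * r' x - p' x * r x = p y * r' y - p' y * r y :=
      fun x hx y hy => isOpen_Ioi.is_const_of_deriv_eq_zero (isPreconnected_Ioi (a := (0 : ℝ)))
        (fun z hz => (hw z hz).differentiableAt.differentiableWithinAt)
        (fun z hz => (hw z hz).deriv) hx hy
    obtain ⟨C₁, hC₁, h₁⟩ := hpb 1 one_pos
    obtain ⟨C₂, hC₂, h₂⟩ := hrb 1 one_pos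
    intro x hx
    have hlim : Tendsto (fun y : ℝ => (2 * C₁ + 2 * C₂ + 2 * (C₁ * C₂)) / y) atTop (𝓝 0) :=
      tendsto_const_nhds.div_atTop tendsto_id
    have hle : ∀ᶠ y : ℝ in atTop, |p x * r' x - p' x * r x - 1| ≤
        (2 * C₁ + 2 * C₂ + 2 * (C₁ * C₂)) / y := by
      filter_upwards [eventually_ge_atTop 1] with y hy
      have hy0 : 0 < y := one_pos.trans_le hy
      rw [hconst x hx y hy0]
      obtain ⟨a1, a2⟩ := h₁ y hy
      obtain ⟨b1, b2⟩ := h₂ y hy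
      have hmul : ∀ u v C : ℝ, |u| ≤ 1 → |v| ≤ C → |u * v| ≤ C := fun u v C hu hv => by
        rw [abs_mul]
        exact (mul_le_of_le_one_left (abs_nonneg _) hu).trans hv
      have hprod : ∀ u v : ℝ, |u| ≤ C₁ / y → |v| ≤ C₂ / y → |u * v| ≤ C₁ * C₂ / y :=
        fun u v hu hv => by
          rw [abs_mul]
          refine (mul_le_mul hu hv (abs_nonneg _) (by positivity)).trans ?_
          rw [div_mul_div_comm]
          gcongr
          nlinarith
      have m1 := hmul _ _ _ (Real.abs_cos_le_one y) b2
      have m2 := hmul _ _ _ (Real.abs_cos_le_one y) a1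
      have m3 := hmul _ _ _ (Real.abs_sin_le_one y) b1
      have m4 := hmul _ _ _ (Real.abs_sin_le_one y) a2
      have m5 := hprod _ _ a1 b2
      have m6 := hprod _ _ a2 b1
      have e : p y * r' y - p' y * r y - 1 =
          Real.cos y * (r' y - Real.cos y) + Real.cos y * (p y - Real.cos y) +
          Real.sin y * (r y - Real.sin y) - Real.sin y * (p' y - -Real.sin y) +
          (p y - Real.cos y) * (r' y - Real.cos y) -
          (p' y - -Real.sin y) * (r y - Real.sin y) := by
        linear_combination Real.sin_sq_add_cos_sq y
      rw [e]
      have hs : (2 * C₁ + 2 * C₂ + 2 * (C₁ * C₂)) / y =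
        C₂ / y + C₁ / y + C₂ / y + C₁ / y + C₁ * C₂ / y + C₁ * C₂ / y := by ring
      rw [hs]
      rw [abs_le] at m1 m2 m3 m4 m5 m6 ⊢
      constructor <;> linarith
    have h0 := abs_nonpos_iff.1 (ge_of_tendsto hlim hle)
    linarith
  · intro ε hε
    obtain ⟨C₁, hC₁, h₁⟩ := hpb ε hε
    obtain ⟨C₂, hC₂, h₂⟩ := hrb ε hε
    have hdiv : ∀ x, ε ≤ x → ∀ u v C : ℝ, 0 ≤ C → |u - v| ≤ C / x → |v| ≤ 1 →
        |u| ≤ 1 + C / ε := by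
      intro x hx u v C hC huv hv
      have h1 : C / x ≤ C / ε := by gcongr
      have h2 := abs_sub_abs_le_abs_sub u v
      linarith
    have hx1 : 0 ≤ C₁ / ε := by positivity
    have hx2 : 0 ≤ C₂ / ε := by positivity
    refine ⟨1 + C₁ + C₂ + C₁ / ε + C₂ / ε, by linarith, fun x hx => ?_⟩
    have hx0 := hε.trans_le hx
    obtain ⟨a1, a2⟩ := h₁ x hx
    obtain ⟨b1, b2⟩ := h₂ x hx
    refine ⟨a1.trans (by gcongr; linarith), b1.trans (by gcongr; linarith), ?_, ?_, ?_, ?_⟩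
    · linarith [hdiv x hx _ _ _ hC₁ a1 (Real.abs_cos_le_one x)]
    · linarith [hdiv x hx _ _ _ hC₁ a2 (by rw [abs_neg]; exact Real.abs_sin_le_one x)]
    · linarith [hdiv x hx _ _ _ hC₂ b1 (Real.abs_sin_le_one x)]
    · linarith [hdiv x hx _ _ _ hC₂ b2 (Real.abs_cos_le_one x)]

end Jost

/-! ### Weighted `L²` functions as tempered distributions -/

section Functions

variable {n : ℕ}

/-- The Japanese bracket `(1 + |ξ| ^ 2) ^ (1 / 2)`. -/
def bracket (ξ : Space n) : ℝ := √(1 + ‖ξ‖ ^ 2)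

theorem bracket_pos (ξ : Space n) : 0 < bracket ξ := Real.sqrt_pos.2 (by positivity)

theorem bracket_sq (ξ : Space n) : bracket ξ ^ 2 = 1 + ‖ξ‖ ^ 2 := Real.sq_sqrt (by positivity)

theorem one_le_bracket (ξ : Space n) : 1 ≤ bracket ξ :=
  Real.one_le_sqrt.2 (by nlinarith [norm_nonneg ξ])

theorem norm_le_bracket (ξ : Space n) : ‖ξ‖ ≤ bracket ξ := Real.le_sqrt_of_sq_le (by linarith)

theorem bracket_eq_rpow (ξ : Space n) : bracket ξ = (1 + ‖ξ‖ ^ 2) ^ ((1 : ℝ) / 2) :=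
  Real.sqrt_eq_rpow _

theorem bracket_inv_eq_rpow (ξ : Space n) : (bracket ξ)⁻¹ = (1 + ‖ξ‖ ^ 2) ^ ((-1 : ℝ) / 2) := by
  rw [bracket_eq_rpow, ← Real.rpow_neg (by positivity)]
  norm_num

theorem continuous_bracket : Continuous (bracket : Space n → ℝ) := by
  unfold bracket
  fun_prop

theorem hasTemperateGrowth_bracket :
    (fun ξ : Space n => (bracket ξ : ℂ)).HasTemperateGrowth := by
  simp_rw [bracket_eq_rpow]
  fun_prop

theorem hasTemperateGrowth_bracket_inv :
    (fun ξ : Space n => ((bracket ξ)⁻¹ : ℂ)).HasTemperateGrowth := by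
  have : (fun ξ : Space n => ((bracket ξ)⁻¹ : ℂ)) =
      fun ξ => (((1 + ‖ξ‖ ^ 2) ^ ((-1 : ℝ) / 2) : ℝ) : ℂ) := by
    ext ξ
    rw [← bracket_inv_eq_rpow, Complex.ofReal_inv]
  rw [this]
  fun_prop

theorem hasTemperateGrowth_bracket_sq :
    (fun ξ : Space n => ((bracket ξ ^ 2 : ℝ) : ℂ)).HasTemperateGrowth := by
  simp_rw [bracket_sq]
  fun_prop

/-- Functions whose quotient by `1 + |ξ| ^ 2` is square integrable. -/
def WeightedL2 (F : Space n → ℂ) : Prop :=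
  MemLp (fun ξ => ((bracket ξ ^ 2 : ℝ) : ℂ)⁻¹ * F ξ) 2

theorem WeightedL2.of_le {F : Space n → ℂ} (hF : AEStronglyMeasurable F) {g : Space n → ℝ}
    (hg : MemLp g 2) (h : ∀ᵐ ξ, ‖F ξ‖ ≤ bracket ξ ^ 2 * g ξ) : WeightedL2 F := by
  refine hg.mono' ?_ ?_
  · refine AEStronglyMeasurable.mul (Measurable.aestronglyMeasurable ?_) hF
    exact (Complex.measurable_ofReal.comp (continuous_bracket.measurable.pow_const 2)).inv
  · filter_upwards [h] with ξ hξ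
    have := bracket_pos ξ
    rw [norm_mul, norm_inv, Complex.norm_real, Real.norm_of_nonneg (by positivity),
      inv_mul_le_iff₀ (by positivity)]
    exact hξ

theorem WeightedL2.aestronglyMeasurable {F : Space n → ℂ} (hF : WeightedL2 F) :
    AEStronglyMeasurable F := by
  have h : AEStronglyMeasurable fun ξ : Space n => ((bracket ξ ^ 2 : ℝ) : ℂ) :=
    (Complex.measurable_ofReal.comp
      (continuous_bracket.measurable.pow_const 2)).aestronglyMeasurable
  refine (h.mul hF.1).congr (ae_of_all _ fun ξ => ?_)
  have : ((bracket ξ ^ 2 : ℝ) : ℂ) ≠ 0 := by exact_mod_cast (pow_pos (bracket_pos ξ) 2).ne'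
  exact mul_inv_cancel_left₀ this _

theorem MemLp.weightedL2 {F : Space n → ℂ} (hF : MemLp F 2) : WeightedL2 F :=
  WeightedL2.of_le hF.1 hF.norm (ae_of_all _ fun ξ =>
    le_mul_of_one_le_left (norm_nonneg _) (one_le_pow₀ (one_le_bracket ξ)))

theorem WeightedL2.add {F G : Space n → ℂ} (hF : WeightedL2 F) (hG : WeightedL2 G) :
    WeightedL2 (F + G) := by
  refine (MemLp.add hF hG).ae_eq (ae_of_all _ fun ξ => ?_)
  simp only [Pi.add_apply]
  ring

theorem WeightedL2.const_smul {F : Space n → ℂ} (hF : WeightedL2 F) (c : ℂ) :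
    WeightedL2 (c • F) := by
  refine (MemLp.const_smul hF c).ae_eq (ae_of_all _ fun ξ => ?_)
  simp only [Pi.smul_apply, smul_eq_mul]
  ring

theorem WeightedL2.sub {F G : Space n → ℂ} (hF : WeightedL2 F) (hG : WeightedL2 G) :
    WeightedL2 (F - G) := by
  refine (MemLp.sub hF hG).ae_eq (ae_of_all _ fun ξ => ?_)
  simp only [Pi.sub_apply]
  ring

theorem WeightedL2.congr {F G : Space n → ℂ} (hF : WeightedL2 F) (h : F =ᵐ[volume] G) :
    WeightedL2 G :=
  MemLp.ae_eq (h.mono fun ξ hξ => by simp only [hξ]) hF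

theorem WeightedL2.integrable_mul {F : Space n → ℂ} (hF : WeightedL2 F) (φ : 𝓢(Space n, ℂ)) :
    Integrable fun ξ => φ ξ * F ξ := by
  have h1 : MemLp (SchwartzMap.smulLeftCLM ℂ (fun ξ => ((bracket ξ ^ 2 : ℝ) : ℂ)) φ) 2 volume :=
    SchwartzMap.memLp _ 2 volume
  refine (h1.integrable_mul hF).congr (ae_of_all _ fun ξ => ?_)
  have : ((bracket ξ ^ 2 : ℝ) : ℂ) ≠ 0 := by exact_mod_cast (pow_pos (bracket_pos ξ) 2).ne'
  simp only [Pi.mul_apply]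
  rw [SchwartzMap.smulLeftCLM_apply_apply hasTemperateGrowth_bracket_sq, smul_eq_mul]
  field_simp

/-- The tempered distribution given by integration against a function. -/
def ofFun (F : Space n → ℂ) : 𝓢'(Space n, ℂ) :=
  open Classical in
  if h : WeightedL2 F then
    TemperedDistribution.smulLeftCLM ℂ (fun ξ => ((bracket ξ ^ 2 : ℝ) : ℂ))
      (Lp.toTemperedDistribution (MemLp.toLp _ h))
  else 0

theorem ofFun_apply {F : Space n → ℂ} (hF : WeightedL2 F) (φ : 𝓢(Space n, ℂ)) :
    ofFun F φ = ∫ ξ, φ ξ * F ξ := by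
  rw [ofFun, dif_pos hF, TemperedDistribution.smulLeftCLM_apply_apply,
    Lp.toTemperedDistribution_apply]
  refine integral_congr_ae ?_
  filter_upwards [MemLp.coeFn_toLp hF] with ξ hξ
  have : ((bracket ξ ^ 2 : ℝ) : ℂ) ≠ 0 := by exact_mod_cast (pow_pos (bracket_pos ξ) 2).ne'
  rw [hξ, SchwartzMap.smulLeftCLM_apply_apply hasTemperateGrowth_bracket_sq, smul_eq_mul,
    smul_eq_mul]
  field_simp

theorem ofFun_congr {F G : Space n → ℂ} (hF : WeightedL2 F) (h : F =ᵐ[volume] G) :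
    ofFun F = ofFun G := by
  ext φ
  rw [ofFun_apply hF, ofFun_apply (hF.congr h)]
  exact integral_congr_ae (h.mono fun ξ hξ => by simp only [hξ])

theorem ofFun_add {F G : Space n → ℂ} (hF : WeightedL2 F) (hG : WeightedL2 G) :
    ofFun (F + G) = ofFun F + ofFun G := by
  ext φ
  rw [add_apply, ofFun_apply hF, ofFun_apply hG, ofFun_apply (hF.add hG),
    ← integral_add (hF.integrable_mul φ) (hG.integrable_mul φ)]
  simp only [Pi.add_apply, mul_add]

theorem ofFun_sub {F G : Space n → ℂ} (hF : WeightedL2 F) (hG : WeightedL2 G) :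
    ofFun (F - G) = ofFun F - ofFun G := by
  ext φ
  rw [sub_apply, ofFun_apply hF, ofFun_apply hG, ofFun_apply (hF.sub hG),
    ← integral_sub (hF.integrable_mul φ) (hG.integrable_mul φ)]
  simp only [Pi.sub_apply, mul_sub]

theorem ofFun_smul {F : Space n → ℂ} (hF : WeightedL2 F) (c : ℂ) :
    ofFun (c • F) = c • ofFun F := by
  ext φ
  rw [smul_apply, ofFun_apply hF, ofFun_apply (hF.const_smul c), smul_eq_mul,
    ← integral_const_mul]
  simp only [Pi.smul_apply, smul_eq_mul]
  congr 1
  ext ξ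
  ring

theorem smulLeftCLM_ofFun {F g : Space n → ℂ} (hg : g.HasTemperateGrowth) (hF : WeightedL2 F)
    (hgF : WeightedL2 fun ξ => g ξ * F ξ) :
    TemperedDistribution.smulLeftCLM ℂ g (ofFun F) = ofFun fun ξ => g ξ * F ξ := by
  ext φ
  rw [TemperedDistribution.smulLeftCLM_apply_apply, ofFun_apply hF, ofFun_apply hgF]
  congr 1
  ext ξ
  rw [SchwartzMap.smulLeftCLM_apply_apply hg, smul_eq_mul]
  ring

theorem ofFun_coe_Lp (f : Lp ℂ 2 (volume : Measure (Space n))) :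
    ofFun f = Lp.toTemperedDistribution f := by
  ext φ
  rw [ofFun_apply (MemLp.weightedL2 (Lp.memLp f)), Lp.toTemperedDistribution_apply]
  rfl

theorem ofFun_eq_toTemperedDistribution {F : Space n → ℂ} (hF : MemLp F 2) :
    ofFun F = Lp.toTemperedDistribution (hF.toLp F) := by
  rw [← ofFun_coe_Lp]
  exact ofFun_congr (MemLp.weightedL2 hF) hF.coeFn_toLp.symm

theorem WeightedL2.locallyIntegrable {F : Space n → ℂ} (hF : WeightedL2 F) :
    LocallyIntegrable F := by
  have h1 : LocallyIntegrable fun ξ : Space n => ((bracket ξ ^ 2 : ℝ) : ℂ)⁻¹ * F ξ :=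
    MemLp.locallyIntegrable hF (by norm_num)
  have h2 : Continuous fun ξ : Space n => ((bracket ξ ^ 2 : ℝ) : ℂ) :=
    Complex.continuous_ofReal.comp (continuous_bracket.pow 2)
  have h3 := h1.continuous_mul h2
  have e : (fun ξ : Space n => ((bracket ξ ^ 2 : ℝ) : ℂ) *
      (((bracket ξ ^ 2 : ℝ) : ℂ)⁻¹ * F ξ)) = F := by
    ext ξ
    have : ((bracket ξ ^ 2 : ℝ) : ℂ) ≠ 0 := by exact_mod_cast (pow_pos (bracket_pos ξ) 2).ne'
    exact mul_inv_cancel_left₀ this _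
  rwa [e] at h3

/-- A function vanishes almost everywhere on each open set on which its distribution vanishes. -/
theorem ae_eq_zero_of_isVanishingOn {F : Space n → ℂ} (hF : WeightedL2 F) {U : Set (Space n)}
    (hU : IsOpen U) (h : Distribution.IsVanishingOn (ofFun F) U) : ∀ᵐ ξ, ξ ∈ U → F ξ = 0 := by
  have hloc := hF.locallyIntegrable
  refine hU.ae_eq_zero_of_integral_contDiff_smul_eq_zero (hloc.locallyIntegrableOn U)
    fun g hg hgc hgU => ?_
  have hg₁ : HasCompactSupport (Complex.ofRealCLM ∘ g) :=
    hgc.comp_left (g := Complex.ofRealCLM) (map_zero _)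
  have hg₂ : ContDiff ℝ ((⊤ : ℕ∞) : WithTop ℕ∞) (Complex.ofRealCLM ∘ g) :=
    Complex.ofRealCLM.contDiff.comp hg
  have hsub : tsupport (Complex.ofRealCLM ∘ g) ⊆ U :=
    (closure_mono (Function.support_comp_subset (map_zero Complex.ofRealCLM) g)).trans hgU
  have h1 := h (hg₁.toSchwartzMap hg₂) hsub
  rw [ofFun_apply hF] at h1
  exact h1

/-- Every point off the support has a neighbourhood on which `F` vanishes almost everywhere, and a
locally null set is null. This turns the assumption on Fourier supports into a lower bound for `‖ξ‖`
almost everywhere where the data are nonzero. -/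
theorem ae_mem_dsupport {F : Space n → ℂ} (hF : WeightedL2 F) :
    ∀ᵐ ξ, F ξ ≠ 0 → ξ ∈ Distribution.dsupport (ofFun F) := by
  rw [ae_iff]
  refine measure_null_of_locally_null _ fun ξ hξ => ?_
  simp only [Classical.not_imp, Set.mem_ofPred_eq, Distribution.notMem_dsupport_iff] at hξ
  obtain ⟨-, s, hs, hso, hξs⟩ := hξ
  refine ⟨_, inter_mem_nhdsWithin _ (hso.mem_nhds hξs), ?_⟩
  refine measure_mono_null (fun η hη => ?_) (ae_iff.1 (ae_eq_zero_of_isVanishingOn hF hso hs))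
  simp only [Classical.not_imp, Set.mem_inter_iff, Set.mem_ofPred_eq] at hη ⊢
  exact ⟨hη.2, hη.1.1⟩

theorem ae_eq_of_ofFun_eq {F G : Space n → ℂ} (hF : WeightedL2 F) (hG : WeightedL2 G)
    (h : ofFun F = ofFun G) : F =ᵐ[volume] G := by
  have h1 := ae_eq_zero_of_isVanishingOn (hF.sub hG) isOpen_univ (fun φ _ => by
    rw [ofFun_sub hF hG, h, sub_self]
    rfl)
  filter_upwards [h1] with ξ hξ
  exact sub_eq_zero.1 (hξ trivial)

/-- The embedding of `L²` into the tempered distributions is injective, so the infimum runs over one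
function only. -/
theorem l2Norm_toTemperedDistribution (g : Lp ℂ 2 (volume : Measure (Space n))) :
    l2Norm (Lp.toTemperedDistribution g) = ‖g‖ₑ := by
  refine le_antisymm (iInf₂_le_of_le g rfl le_rfl) (le_iInf₂ fun g' h => ?_)
  have hinj : g = g' := by
    have hk := LinearMap.ker_eq_bot.1 (Lp.ker_toTemperedDistributionCLM_eq_bot (E := Space n)
      (F := ℂ) (μ := volume) (p := 2))
    exact hk h
  rw [hinj]

/-- Plancherel's theorem; all norm estimates reduce through it to pointwise ones in frequency. -/
theorem l2Norm_fourierInv_ofFun {F : Space n → ℂ} (hF : MemLp F 2) :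
    l2Norm (𝓕⁻ (ofFun F)) = eLpNorm F 2 := by
  rw [ofFun_eq_toTemperedDistribution hF, Lp.fourierInv_toTemperedDistribution_eq,
    l2Norm_toTemperedDistribution]
  have h : ‖(𝓕⁻ (hF.toLp F) : Lp ℂ 2 (volume : Measure (Space n)))‖ = ‖hF.toLp F‖ := by
    rw [← Lp.norm_fourier_eq, FourierTransform.fourier_fourierInv_eq]
  rw [← ofReal_norm, h, ofReal_norm, Lp.enorm_toLp]

theorem besselPotential_neg_one_fourierInv_ofFun {F : Space n → ℂ} (hF : WeightedL2 F)
    (hF' : MemLp (fun ξ => ((bracket ξ)⁻¹ : ℂ) * F ξ) 2) :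
    TemperedDistribution.besselPotential (Space n) ℂ (-1) (𝓕⁻ (ofFun F)) =
      𝓕⁻ (ofFun fun ξ => ((bracket ξ)⁻¹ : ℂ) * F ξ) := by
  rw [TemperedDistribution.besselPotential, TemperedDistribution.fourierMultiplierCLM_apply,
    FourierTransform.fourier_fourierInv_eq, ← smulLeftCLM_ofFun hasTemperateGrowth_bracket_inv hF
      (MemLp.weightedL2 hF')]
  congr 3
  ext ξ
  rw [← bracket_inv_eq_rpow, Complex.ofReal_inv]

theorem sobolevNorm_fourierInv_ofFun {F : Space n → ℂ} (hF : WeightedL2 F)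
    (hF' : MemLp (fun ξ => ((bracket ξ)⁻¹ : ℂ) * F ξ) 2) :
    sobolevNorm (-1) (𝓕⁻ (ofFun F)) = eLpNorm (fun ξ => ((bracket ξ)⁻¹ : ℂ) * F ξ) 2 := by
  rw [sobolevNorm, besselPotential_neg_one_fourierInv_ofFun hF hF', l2Norm_fourierInv_ofFun hF']

theorem exists_fourier_eq_ofFun {f : 𝓢'(Space n, ℂ)}
    (hf : TemperedDistribution.MemSobolev 0 2 f) :
    ∃ F : Space n → ℂ, MemLp F 2 ∧ 𝓕 f = ofFun F := by
  obtain ⟨g, hg⟩ := TemperedDistribution.memSobolev_zero_iff_exists_fourier.1 hf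
  exact ⟨g, Lp.memLp g, by rw [hg, ofFun_coe_Lp]⟩

theorem exists_fourier_eq_ofFun_neg_one {f : 𝓢'(Space n, ℂ)}
    (hf : TemperedDistribution.MemSobolev (-1) 2 f) :
    ∃ F : Space n → ℂ, WeightedL2 F ∧ MemLp (fun ξ => ((bracket ξ)⁻¹ : ℂ) * F ξ) 2 ∧
      𝓕 f = ofFun F := by
  obtain ⟨g, hg⟩ := TemperedDistribution.memSobolev_iff_exists_smulLeftCLM_fourier.1 hf
  have hb : ∀ ξ : Space n, (bracket ξ : ℂ) ≠ 0 := fun ξ => by exact_mod_cast (bracket_pos ξ).ne'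
  have hw : WeightedL2 fun ξ => (bracket ξ : ℂ) * g ξ := by
    refine WeightedL2.of_le (AEStronglyMeasurable.mul
      (Complex.continuous_ofReal.comp continuous_bracket).aestronglyMeasurable (Lp.memLp g).1)
      (Lp.memLp g).norm (ae_of_all _ fun ξ => ?_)
    rw [norm_mul, Complex.norm_real, Real.norm_of_nonneg (bracket_pos ξ).le, sq]
    gcongr
    exact le_mul_of_one_le_left (bracket_pos ξ).le (one_le_bracket ξ)
  refine ⟨fun ξ => (bracket ξ : ℂ) * g ξ, hw, ?_, ?_⟩
  · refine (Lp.memLp g).ae_eq (ae_of_all _ fun ξ => ?_)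
    exact (inv_mul_cancel_left₀ (hb ξ) _).symm
  · rw [← smulLeftCLM_ofFun hasTemperateGrowth_bracket (MemLp.weightedL2 (Lp.memLp g)) hw,
      ofFun_coe_Lp, ← hg]
    rw [TemperedDistribution.smulLeftCLM_smulLeftCLM_apply (by fun_prop)
      hasTemperateGrowth_bracket]
    have h1 : ((fun ξ : Space n => (((1 + ‖ξ‖ ^ 2) ^ ((-1 : ℝ) / 2) : ℝ) : ℂ)) *
        fun ξ => (bracket ξ : ℂ)) = fun _ => 1 := by
      ext ξ
      rw [Pi.mul_apply, ← bracket_inv_eq_rpow, Complex.ofReal_inv]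
      exact inv_mul_cancel₀ (hb ξ)
    rw [h1, TemperedDistribution.smulLeftCLM_const, one_smul]

/-- The kernel `exp (-2 π i x · ξ)` makes the angular frequency `2 π ‖ξ‖`. -/
theorem fourier_laplacian (f : 𝓢'(Space n, ℂ)) (φ : 𝓢(Space n, ℂ)) :
    (𝓕 (Δ f)) φ =
      -(𝓕 f) (SchwartzMap.smulLeftCLM ℂ
        (fun ξ : Space n => (((2 * Real.pi * ‖ξ‖) ^ 2 : ℝ) : ℂ)) φ) := by
  have hg : (fun ξ : Space n => ((‖ξ‖ ^ 2 : ℝ) : ℂ)).HasTemperateGrowth := by fun_prop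
  have e : (fun ξ : Space n => (((2 * Real.pi * ‖ξ‖) ^ 2 : ℝ) : ℂ)) =
      (((2 * Real.pi) ^ 2 : ℝ) : ℂ) • fun ξ : Space n => ((‖ξ‖ ^ 2 : ℝ) : ℂ) := by
    ext ξ
    simp only [Pi.smul_apply, smul_eq_mul]
    push_cast
    ring
  rw [e, SchwartzMap.smulLeftCLM_smul hg, smul_apply, map_smul,
    TemperedDistribution.laplacian_eq_fourierMultiplierCLM]
  have h1 : 𝓕 (-(2 * Real.pi) ^ 2 • TemperedDistribution.fourierMultiplierCLM ℂ
      (fun x : Space n => Complex.ofReal (‖x‖ ^ 2)) f) = -(((2 * Real.pi) ^ 2 : ℝ) : ℂ) •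
      TemperedDistribution.smulLeftCLM ℂ (fun ξ : Space n => ((‖ξ‖ ^ 2 : ℝ) : ℂ)) (𝓕 f) := by
    ext ψ
    rw [TemperedDistribution.fourierMultiplierCLM_apply]
    simp
  rw [h1]
  simp

/-- Differentiation under the integral sign. -/
theorem hasDerivAt_ofFun {y y' : ℝ → Space n → ℂ} {s : Set ℝ} {t : ℝ} (hs : s ∈ 𝓝 t)
    (hy : ∀ τ ∈ s, WeightedL2 (y τ)) (hy' : WeightedL2 (y' t)) {g : Space n → ℝ}
    (hg : MemLp g 2) (hb : ∀ᵐ ξ, ∀ τ ∈ s, ‖y' τ ξ‖ ≤ bracket ξ ^ 2 * g ξ)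
    (hd : ∀ᵐ ξ, ∀ τ ∈ s, HasDerivAt (fun τ => y τ ξ) (y' τ ξ) τ) (φ : 𝓢(Space n, ℂ)) :
    HasDerivAt (fun τ => ofFun (y τ) φ) (ofFun (y' t) φ) t := by
  have hbi : Integrable fun ξ => ‖φ ξ‖ * (bracket ξ ^ 2 * g ξ) := by
    have h1 : MemLp (SchwartzMap.smulLeftCLM ℂ (fun ξ => ((bracket ξ ^ 2 : ℝ) : ℂ)) φ) 2 volume :=
      SchwartzMap.memLp _ 2 volume
    refine (h1.norm.integrable_mul hg).congr (ae_of_all _ fun ξ => ?_)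
    simp only [Pi.mul_apply]
    rw [SchwartzMap.smulLeftCLM_apply_apply hasTemperateGrowth_bracket_sq, norm_smul,
      Complex.norm_real, Real.norm_of_nonneg (by positivity)]
    ring
  have h := (hasDerivAt_integral_of_dominated_loc_of_deriv_le (μ := volume) hs
    (F := fun τ ξ => φ ξ * y τ ξ) (F' := fun τ ξ => φ ξ * y' τ ξ) (x₀ := t)
    (bound := fun ξ => ‖φ ξ‖ * (bracket ξ ^ 2 * g ξ))
    (by filter_upwards [hs] with τ hτ using ((hy τ hτ).integrable_mul φ).1)
    ((hy t (mem_of_mem_nhds hs)).integrable_mul φ) (hy'.integrable_mul φ).1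
    (by
      filter_upwards [hb] with ξ hξ τ hτ
      rw [norm_mul]
      gcongr
      exact hξ τ hτ) hbi
    (by
      filter_upwards [hd] with ξ hξ τ hτ
      exact (hξ τ hτ).const_mul _)).2
  rw [ofFun_apply hy']
  refine h.congr_of_eventuallyEq ?_
  filter_upwards [hs] with τ hτ
  exact ofFun_apply (hy τ hτ) φ

end Functions

/-! ### Time profiles of the free and the damped oscillator -/

section Profiles

/-- A time profile `θ t k` solving `θ_tt + k ^ 2 θ + b θ_t = 0` with polynomial bounds for
frequencies `k ≥ κ`, locally uniformly in time. -/
structure OscProfile (I : Set ℝ) (κ : ℝ) (b : ℝ → ℝ) (θ θ₁ : ℝ → ℝ → ℝ) : Prop where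
  measurable : ∀ t, Measurable (θ t)
  measurable_deriv : ∀ t, Measurable (θ₁ t)
  hasDerivAt : ∀ k, κ ≤ k → ∀ t ∈ I, HasDerivAt (fun t => θ t k) (θ₁ t k) t
  hasDerivAt_deriv : ∀ k, κ ≤ k → ∀ t ∈ I,
    HasDerivAt (fun t => θ₁ t k) (-(k ^ 2 * θ t k + b t * θ₁ t k)) t
  bound : ∀ t ∈ I, ∃ s ∈ 𝓝 t, ∃ B, s ⊆ I ∧ 0 ≤ B ∧ ∀ τ ∈ s, ∀ k, κ ≤ k →
    |θ τ k| ≤ B * (1 + k ^ 2) ∧ |θ₁ τ k| ≤ B * (1 + k ^ 2) ∧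
      |-(k ^ 2 * θ τ k + b τ * θ₁ τ k)| ≤ B * (1 + k ^ 2)

theorem oscProfile_cos {κ : ℝ} (hκ : 0 ≤ κ) :
    OscProfile Set.univ κ (fun _ => 0) (fun t k => Real.cos (t * k))
      (fun t k => -(k * Real.sin (t * k))) where
  measurable t := by fun_prop
  measurable_deriv t := by fun_prop
  hasDerivAt k _ t _ := (((hasDerivAt_id t).mul_const k).cos).congr_deriv (by simp [mul_comm])
  hasDerivAt_deriv k _ t _ :=
    ((((hasDerivAt_id t).mul_const k).sin.const_mul k).neg).congr_deriv (by simp; ring)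
  bound t _ := by
    refine ⟨Set.univ, univ_mem, 1, subset_rfl, zero_le_one, fun τ _ k hk => ?_⟩
    have hk0 : 0 ≤ k := hκ.trans hk
    have h1 := Real.abs_cos_le_one (τ * k)
    have h2 := Real.abs_sin_le_one (τ * k)
    refine ⟨by nlinarith, ?_, ?_⟩
    · rw [abs_neg, abs_mul, abs_of_nonneg hk0]
      nlinarith
    · rw [abs_neg, zero_mul, add_zero, abs_mul, abs_of_nonneg (sq_nonneg k)]
      nlinarith [sq_nonneg k]

theorem oscProfile_sin {κ : ℝ} (hκ : 0 ≤ κ) :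
    OscProfile Set.univ κ (fun _ => 0) (fun t k => Real.sin (t * k))
      (fun t k => k * Real.cos (t * k)) where
  measurable t := by fun_prop
  measurable_deriv t := by fun_prop
  hasDerivAt k _ t _ := (((hasDerivAt_id t).mul_const k).sin).congr_deriv (by simp [mul_comm])
  hasDerivAt_deriv k _ t _ :=
    (((hasDerivAt_id t).mul_const k).cos.const_mul k).congr_deriv (by simp; ring)
  bound t _ := by
    refine ⟨Set.univ, univ_mem, 1, subset_rfl, zero_le_one, fun τ _ k hk => ?_⟩
    have hk0 : 0 ≤ k := hκ.trans hk
    have h1 := Real.abs_cos_le_one (τ * k)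
    have h2 := Real.abs_sin_le_one (τ * k)
    refine ⟨by nlinarith, ?_, ?_⟩
    · rw [abs_mul, abs_of_nonneg hk0]
      nlinarith
    · rw [abs_neg, zero_mul, add_zero, abs_mul, abs_of_nonneg (sq_nonneg k)]
      nlinarith [sq_nonneg k]

/-- A solution of `q'' + (1 + μ (1 - μ) / x ^ 2) q = 0` yields a profile for the weakly damped
wave equation. -/
theorem oscProfile_damped {κ μ : ℝ} (hκ : 0 < κ) {q q' : ℝ → ℝ} (hqm : Measurable q)
    (hqm' : Measurable q') (hq : ∀ x, 0 < x → HasDerivAt q (q' x) x)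
    (hq' : ∀ x, 0 < x → HasDerivAt q' (-((1 + (μ - μ ^ 2) / x ^ 2) * q x)) x)
    (hb : ∀ ε, 0 < ε → ∃ C, 0 ≤ C ∧ ∀ x, ε ≤ x → |q x| ≤ C ∧ |q' x| ≤ C) :
    OscProfile (Set.Ioi 0) κ (fun t => 2 * μ / t) (fun t k => t ^ (-μ) * q (t * k))
      (fun t k => t ^ (-μ) * (k * q' (t * k) - μ / t * q (t * k))) where
  measurable t := (hqm.comp (measurable_const_mul t)).const_mul _
  measurable_deriv t := ((measurable_id.mul (hqm'.comp (measurable_const_mul t))).sub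
    ((hqm.comp (measurable_const_mul t)).const_mul _)).const_mul _
  hasDerivAt k hk t ht := by
    have ht0 : (0 : ℝ) < t := ht
    have hk0 : 0 < k := hκ.trans_le hk
    have h1 := Real.hasDerivAt_rpow_const (x := t) (p := -μ) (Or.inl ht0.ne')
    have h2 := (hq (t * k) (mul_pos ht0 hk0)).comp t ((hasDerivAt_id t).mul_const k)
    refine (h1.mul h2).congr_deriv ?_
    rw [Real.rpow_sub_one ht0.ne']
    simp only [Function.comp, id]
    field_simp
    ring
  hasDerivAt_deriv k hk t ht := by
    have ht0 : (0 : ℝ) < t := ht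
    have hk0 : 0 < k := hκ.trans_le hk
    have h1 := Real.hasDerivAt_rpow_const (x := t) (p := -μ) (Or.inl ht0.ne')
    have h2 := (hq (t * k) (mul_pos ht0 hk0)).comp t ((hasDerivAt_id t).mul_const k)
    have h3 := (hq' (t * k) (mul_pos ht0 hk0)).comp t ((hasDerivAt_id t).mul_const k)
    have h4 := (hasDerivAt_inv ht0.ne').const_mul μ
    refine (h1.mul ((h3.const_mul k).sub (h4.mul h2))).congr_deriv ?_
    rw [Real.rpow_sub_one ht0.ne']
    simp only [Function.comp, id, Pi.sub_apply, Pi.mul_apply]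
    field_simp
    ring
  bound t ht := by
    have ht0 : (0 : ℝ) < t := ht
    -- For `τ ∈ [t / 2, 2 * t]` and `k ≥ κ` the argument `τ * k` is at least `t / 2 * κ`, so a
    -- single constant bounds `q` and `q'`, uniformly in `k`.
    obtain ⟨C, hC0, hC⟩ := hb (t / 2 * κ) (by positivity)
    obtain ⟨V, hV⟩ := (isCompact_Icc (a := t / 2) (b := 2 * t)).exists_bound_of_continuousOn
      (f := fun t : ℝ => t ^ (-μ)) fun x hx =>
        (Real.continuousAt_rpow_const x _
          (Or.inl (by linarith [hx.1] : (0 : ℝ) < x).ne')).continuousWithinAt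
    have hV0 : 0 ≤ V := (norm_nonneg _).trans (hV t ⟨by linarith, by linarith⟩)
    set m : ℝ := |μ| / (t / 2) with hm
    have hm0 : 0 ≤ m := by positivity
    refine ⟨Set.Icc (t / 2) (2 * t), Icc_mem_nhds (by linarith) (by linarith),
      V * C * (2 + m + (2 * m) * (1 + m)), fun x hx => by
        have := hx.1
        exact lt_of_lt_of_le (by positivity) this, by positivity, fun τ hτ k hk => ?_⟩
    have hk0 : 0 < k := hκ.trans_le hk
    have hτ0 : 0 < τ := lt_of_lt_of_le (by positivity) hτ.1
    have hVτ : |τ ^ (-μ)| ≤ V := hV τ hτ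
    obtain ⟨hq1, hq2⟩ := hC (τ * k) (mul_le_mul hτ.1 hk hκ.le hτ0.le)
    have hmτ : |μ / τ| ≤ m := by
      rw [abs_div, abs_of_pos hτ0, hm]
      gcongr
      exact hτ.1
    have hθ : |τ ^ (-μ) * q (τ * k)| ≤ V * C := by
      rw [abs_mul]
      gcongr
    have hθ₁ : |τ ^ (-μ) * (k * q' (τ * k) - μ / τ * q (τ * k))| ≤ V * C * (k + m) := by
      rw [abs_mul, mul_assoc V]
      refine mul_le_mul hVτ ((abs_sub _ _).trans ?_) (abs_nonneg _) hV0
      rw [abs_mul, abs_mul, abs_of_pos hk0]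
      have h1 : k * |q' (τ * k)| ≤ k * C := by gcongr
      have h2 : |μ / τ| * |q (τ * k)| ≤ m * C := by gcongr
      linarith
    have hk2 : k ≤ 1 + k ^ 2 := by nlinarith [sq_nonneg (k - 1)]
    have hVC : 0 ≤ V * C := by positivity
    have hkm : V * C * (k + m) ≤ V * C * ((1 + m) * (1 + k ^ 2)) := by
      gcongr
      nlinarith [mul_nonneg hm0 (sq_nonneg k)]
    have hrest : 0 ≤ V * C * (1 + k ^ 2) := by positivity
    have hrest' : 0 ≤ V * C * (1 + k ^ 2) * m := by positivity
    have hrest'' : 0 ≤ V * C * (1 + k ^ 2) * m * m := by positivity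
    refine ⟨hθ.trans ?_, (hθ₁.trans hkm).trans ?_, ?_⟩
    · have h3 : V * C ≤ V * C * (1 + k ^ 2) := le_mul_of_one_le_right hVC (by nlinarith)
      nlinarith
    · nlinarith
    · rw [abs_neg]
      have h5 : |2 * μ / τ| ≤ 2 * m := by
        rw [mul_div_assoc, abs_mul, abs_two]
        linarith
      calc _ ≤ |k ^ 2 * (τ ^ (-μ) * q (τ * k))| +
          |2 * μ / τ * (τ ^ (-μ) * (k * q' (τ * k) - μ / τ * q (τ * k)))| := abs_add_le _ _
        _ ≤ k ^ 2 * (V * C) + 2 * m * (V * C * ((1 + m) * (1 + k ^ 2))) := by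
          rw [abs_mul (k ^ 2), abs_mul (2 * μ / τ), abs_of_nonneg (sq_nonneg k)]
          exact add_le_add (mul_le_mul_of_nonneg_left hθ (sq_nonneg k))
            (mul_le_mul h5 (hθ₁.trans hkm) (abs_nonneg _) (by positivity))
        _ ≤ _ := by nlinarith

end Profiles

/-! ### From scalar profiles to weak solutions in frequency -/

section Modes

variable {n : ℕ}

/-- The angular frequency belonging to the frequency variable of the Fourier transform. -/
def freq (ξ : Space n) : ℝ := 2 * Real.pi * ‖ξ‖

theorem measurable_freq : Measurable (freq : Space n → ℝ) := measurable_norm.const_mul _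

theorem le_freq {δ : ℝ} {ξ : Space n} (h : δ ≤ ‖ξ‖) : 2 * Real.pi * δ ≤ freq ξ := by
  unfold freq
  gcongr

theorem one_add_freq_sq_le (ξ : Space n) :
    1 + freq ξ ^ 2 ≤ bracket ξ ^ 2 * (2 * Real.pi) ^ 2 := by
  rw [bracket_sq, freq]
  nlinarith [Real.pi_gt_three]

/-- The multiplier with the square of the frequency. -/
abbrev freqSq (n : ℕ) : 𝓢(Space n, ℂ) →L[ℂ] 𝓢(Space n, ℂ) :=
  SchwartzMap.smulLeftCLM ℂ (fun ξ : Space n => ((freq ξ ^ 2 : ℝ) : ℂ))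

theorem hasTemperateGrowth_freq_sq :
    (fun ξ : Space n => ((freq ξ ^ 2 : ℝ) : ℂ)).HasTemperateGrowth := by
  simp_rw [freq, mul_pow]
  fun_prop

/-- The oscillating mode `θ t |ξ| α(ξ)`. -/
def mode (θ : ℝ → ℝ → ℝ) (α : Space n → ℂ) (t : ℝ) (ξ : Space n) : ℂ := (θ t (freq ξ) : ℂ) * α ξ

/-- `D` solves `D_tt + |ξ| ^ 2 D + b D_t = 0` on `I` in the weak sense, with `D₁ = D_t`. -/
structure FourierSolution (I : Set ℝ) (b : ℝ → ℝ) (D D₁ : ℝ → 𝓢'(Space n, ℂ)) : Prop where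
  hasDerivAt : ∀ φ : 𝓢(Space n, ℂ), ∀ t ∈ I, HasDerivAt (fun s => D s φ) (D₁ t φ) t
  hasDerivAt_deriv : ∀ φ : 𝓢(Space n, ℂ), ∀ t ∈ I,
    HasDerivAt (fun s => D₁ s φ) (-(D t (freqSq n φ) + (b t : ℂ) * D₁ t φ)) t

theorem FourierSolution.add {I : Set ℝ} {b : ℝ → ℝ} {D D₁ G G₁ : ℝ → 𝓢'(Space n, ℂ)}
    (hD : FourierSolution I b D D₁) (hG : FourierSolution I b G G₁) :
    FourierSolution I b (fun t => D t + G t) (fun t => D₁ t + G₁ t) where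
  hasDerivAt φ t ht := (hD.hasDerivAt φ t ht).add (hG.hasDerivAt φ t ht)
  hasDerivAt_deriv φ t ht :=
    ((hD.hasDerivAt_deriv φ t ht).add (hG.hasDerivAt_deriv φ t ht)).congr_deriv (by
      simp only [add_apply]
      ring)

variable {I : Set ℝ} {δ : ℝ} {b : ℝ → ℝ} {θ θ₁ : ℝ → ℝ → ℝ} {α : Space n → ℂ}

/-- Where `α` is nonzero the frequency is at least `2 * π * δ` and the profile bound applies;
elsewhere the mode is zero. Quadratic growth in the frequency is just what the weight `bracket ξ ^
2` absorbs. -/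
theorem norm_mode_le {s : Set ℝ} {B : ℝ} (hsupp : ∀ᵐ ξ, α ξ ≠ 0 → δ ≤ ‖ξ‖)
    (hB : ∀ τ ∈ s, ∀ k, 2 * Real.pi * δ ≤ k → |θ τ k| ≤ B * (1 + k ^ 2)) (hB0 : 0 ≤ B) :
    ∀ᵐ ξ, ∀ τ ∈ s, ‖mode θ α τ ξ‖ ≤ bracket ξ ^ 2 * (B * (2 * Real.pi) ^ 2 * ‖α ξ‖) := by
  filter_upwards [hsupp] with ξ hξ τ hτ
  by_cases h0 : α ξ = 0
  · simp [mode, h0]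
  rw [mode, norm_mul, Complex.norm_real, Real.norm_eq_abs]
  calc |θ τ (freq ξ)| * ‖α ξ‖ ≤ B * (1 + freq ξ ^ 2) * ‖α ξ‖ := by
        gcongr
        exact hB τ hτ _ (le_freq (hξ h0))
    _ ≤ B * (bracket ξ ^ 2 * (2 * Real.pi) ^ 2) * ‖α ξ‖ := by
        gcongr
        exact one_add_freq_sq_le ξ
    _ = _ := by ring

theorem weightedL2_mode (hα : MemLp α 2) (hsupp : ∀ᵐ ξ, α ξ ≠ 0 → δ ≤ ‖ξ‖) {t B : ℝ}
    (hm : Measurable (θ t)) (hB0 : 0 ≤ B)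
    (hB : ∀ k, 2 * Real.pi * δ ≤ k → |θ t k| ≤ B * (1 + k ^ 2)) : WeightedL2 (mode θ α t) := by
  refine WeightedL2.of_le (g := fun ξ => B * (2 * Real.pi) ^ 2 * ‖α ξ‖) ?_ (hα.norm.const_mul _) ?_
  · exact ((Complex.measurable_ofReal.comp
      (hm.comp measurable_freq)).aestronglyMeasurable).mul hα.1
  · filter_upwards [norm_mode_le (s := {t}) hsupp (by simpa using hB) hB0] with ξ hξ
    exact hξ t rfl

theorem OscProfile.weightedL2 (hθ : OscProfile I (2 * Real.pi * δ) b θ θ₁) (hα : MemLp α 2)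
    (hsupp : ∀ᵐ ξ, α ξ ≠ 0 → δ ≤ ‖ξ‖) {t : ℝ} (ht : t ∈ I) : WeightedL2 (mode θ α t) := by
  obtain ⟨s, hs, B, -, hB0, hB⟩ := hθ.bound t ht
  exact weightedL2_mode hα hsupp (hθ.measurable t) hB0
    fun k hk => (hB t (mem_of_mem_nhds hs) k hk).1

theorem OscProfile.weightedL2_deriv (hθ : OscProfile I (2 * Real.pi * δ) b θ θ₁) (hα : MemLp α 2)
    (hsupp : ∀ᵐ ξ, α ξ ≠ 0 → δ ≤ ‖ξ‖) {t : ℝ} (ht : t ∈ I) : WeightedL2 (mode θ₁ α t) := by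
  obtain ⟨s, hs, B, -, hB0, hB⟩ := hθ.bound t ht
  exact weightedL2_mode hα hsupp (hθ.measurable_deriv t) hB0
    fun k hk => (hB t (mem_of_mem_nhds hs) k hk).2.1

/-- The local uniformity of the profile bounds in time supplies the dominating function for
differentiating twice under the integral. The second derivative is then rewritten by the ODE, with
`k ^ 2` moved onto the test function. -/
theorem OscProfile.fourierSolution (hθ : OscProfile I (2 * Real.pi * δ) b θ θ₁) (hα : MemLp α 2)
    (hsupp : ∀ᵐ ξ, α ξ ≠ 0 → δ ≤ ‖ξ‖) :
    FourierSolution I b (fun t => ofFun (mode θ α t)) (fun t => ofFun (mode θ₁ α t)) where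
  hasDerivAt φ t ht := by
    obtain ⟨s, hs, B, hsI, hB0, hB⟩ := hθ.bound t ht
    refine hasDerivAt_ofFun hs (fun τ hτ => hθ.weightedL2 hα hsupp (hsI hτ))
      (hθ.weightedL2_deriv hα hsupp ht) (hα.norm.const_mul (B * (2 * Real.pi) ^ 2))
      (norm_mode_le hsupp (fun τ hτ k hk => (hB τ hτ k hk).2.1) hB0) ?_ φ
    filter_upwards [hsupp] with ξ hξ τ hτ
    by_cases h0 : α ξ = 0
    · simpa [mode, h0] using hasDerivAt_const τ (0 : ℂ)
    · exact ((hθ.hasDerivAt _ (le_freq (hξ h0)) τ (hsI hτ)).ofReal_comp).mul_const _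
  hasDerivAt_deriv φ t ht := by
    obtain ⟨s, hs, B, hsI, hB0, hB⟩ := hθ.bound t ht
    set θ₂ : ℝ → ℝ → ℝ := fun t k => -(k ^ 2 * θ t k + b t * θ₁ t k) with hθ₂
    have hw := hθ.weightedL2 hα hsupp ht
    have hw₁ := hθ.weightedL2_deriv hα hsupp ht
    have hw₂ : WeightedL2 (mode θ₂ α t) :=
      weightedL2_mode hα hsupp ((((measurable_id.pow_const 2).mul (hθ.measurable t)).add
        ((hθ.measurable_deriv t).const_mul _)).neg) hB0
        fun k hk => (hB t (mem_of_mem_nhds hs) k hk).2.2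
    have h := hasDerivAt_ofFun hs (fun τ hτ => hθ.weightedL2_deriv hα hsupp (hsI hτ)) hw₂
      (hα.norm.const_mul (B * (2 * Real.pi) ^ 2))
      (norm_mode_le hsupp (fun τ hτ k hk => (hB τ hτ k hk).2.2) hB0) (by
        filter_upwards [hsupp] with ξ hξ τ hτ
        by_cases h0 : α ξ = 0
        · simpa [mode, h0] using hasDerivAt_const τ (0 : ℂ)
        · exact ((hθ.hasDerivAt_deriv _ (le_freq (hξ h0)) τ (hsI hτ)).ofReal_comp).mul_const _) φ
    refine h.congr_deriv ?_
    rw [ofFun_apply hw₂, ofFun_apply hw, ofFun_apply hw₁, ← integral_const_mul,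
      ← integral_add (hw.integrable_mul _) ((hw₁.integrable_mul φ).const_mul _), ← integral_neg]
    congr 1
    ext ξ
    rw [SchwartzMap.smulLeftCLM_apply_apply hasTemperateGrowth_freq_sq, smul_eq_mul]
    simp only [mode, hθ₂]
    push_cast
    ring

end Modes

/-! ### Passage between weak solutions in frequency and Cauchy problems -/

section Solutions

variable {n : ℕ}

/-- A weak solution on the Fourier side of the free wave equation gives a free wave. -/
theorem FourierSolution.solvesCauchyProblem {D D₁ : ℝ → 𝓢'(Space n, ℂ)}
    (hD : FourierSolution Set.univ (fun _ => 0) D D₁) :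
    SolvesCauchyProblem (fun _ => 0) Set.univ (fun t => 𝓕⁻ (D t)) (𝓕⁻ (D 1)) (𝓕⁻ (D₁ 1)) := by
  refine ⟨fun t => 𝓕⁻ (D₁ t), fun t => -𝓕⁻ (TemperedDistribution.smulLeftCLM ℂ
    (fun ξ : Space n => ((freq ξ ^ 2 : ℝ) : ℂ)) (D t)), fun φ t ht => ?_, fun φ t ht => ?_,
    fun φ => ?_, fun t _ => ?_, rfl, rfl⟩
  · exact (hD.hasDerivAt (𝓕⁻ φ) t ht).hasDerivWithinAt
  · refine ((hD.hasDerivAt_deriv (𝓕⁻ φ) t ht).congr_deriv ?_).hasDerivWithinAt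
    simp only [Complex.ofReal_zero, zero_mul, add_zero]
    rfl
  -- The second time derivative tested with `φ` is, up to sign, `D` tested with another Schwartz
  -- function, hence even differentiable in time.
  · intro t ht
    exact ((hD.hasDerivAt (freqSq n (𝓕⁻ φ)) t ht).continuousAt.neg).continuousWithinAt
  · ext φ
    have h := fourier_laplacian (𝓕⁻ (D t)) (𝓕⁻ φ)
    rw [FourierTransform.fourier_fourierInv_eq] at h
    have h' : (Δ (𝓕⁻ (D t))) φ = -(D t) (freqSq n (𝓕⁻ φ)) := by
      rw [TemperedDistribution.fourier_apply, FourierTransform.fourier_fourierInv_eq] at h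
      exact h
    change -(D t) (freqSq n (𝓕⁻ φ)) - (Δ (𝓕⁻ (D t))) φ + ((0 : ℝ) : ℂ) * (D₁ t) (𝓕⁻ φ) = 0
    rw [h', Complex.ofReal_zero]
    ring

/-- The Fourier transform of a solution of the weakly damped wave equation is determined by its
data. -/
theorem FourierSolution.fourier_eq {μ : ℝ} {D D₁ : ℝ → 𝓢'(Space n, ℂ)}
    (hD : FourierSolution (Set.Ioi 0) (fun t => 2 * μ / t) D D₁) {u : ℝ → 𝓢'(Space n, ℂ)}
    {u₀ u₁ : 𝓢'(Space n, ℂ)}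
    (hu : SolvesCauchyProblem (fun t => 2 * μ / t) (Set.Ici 1) u u₀ u₁)
    (h0 : D 1 = 𝓕 u₀) (h1 : D₁ 1 = 𝓕 u₁) : ∀ t ∈ Set.Ici (1 : ℝ), 𝓕 (u t) = D t := by
  obtain ⟨ut, utt, hut, hutt, -, heq, hu0, hu1⟩ := hu
  have hpos : ∀ t ∈ Set.Ici (1 : ℝ), t ∈ Set.Ioi (0 : ℝ) := fun t ht =>
    lt_of_lt_of_le (one_pos (α := ℝ)) (Set.mem_Ici.1 ht)
  -- The difference of the two solutions has zero data, and on the Fourier side the Laplacian is a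
  -- smooth multiplier of temperate growth.
  have key := eq_zero_of_weakly_damped (hasTemperateGrowth_freq_sq (n := n)) μ
    (D := fun t => 𝓕 (u t) - D t) (D₁ := fun t => 𝓕 (ut t) - D₁ t)
    (D₂ := fun t => 𝓕 (utt t) - -(TemperedDistribution.smulLeftCLM ℂ
      (fun ξ : Space n => ((freq ξ ^ 2 : ℝ) : ℂ)) (D t) + ((2 * μ / t : ℝ) : ℂ) • D₁ t))
    (fun φ t ht => (hut (𝓕 φ) t ht).sub (hD.hasDerivAt φ t (hpos t ht)).hasDerivWithinAt)
    (fun φ t ht => (hutt (𝓕 φ) t ht).sub (hD.hasDerivAt_deriv φ t (hpos t ht)).hasDerivWithinAt)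
    (fun φ t ht => by
      have h2 := congrArg (fun T : 𝓢'(Space n, ℂ) => T (𝓕 φ)) (heq t ht)
      have h3 := fourier_laplacian (u t) φ
      simp only [add_apply, sub_apply, smul_apply, smul_eq_mul, neg_apply,
        TemperedDistribution.fourier_apply, TemperedDistribution.smulLeftCLM_apply_apply,
        zero_apply] at h2 h3 ⊢
      rw [h3] at h2
      simp only [freq] at h2 ⊢
      linear_combination h2)
    (by simp [hu0, h0]) (by simp [hu1, h1])
  exact fun t ht => sub_eq_zero.1 (key t ht)

end Solutions

/-! ### Jost coefficients of the Cauchy data -/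

section Scattering

variable {n : ℕ}

/-- The coefficient of one Jost solution in the expansion of the solution with data `F₀, F₁`, in
terms of the other Jost solution `q` and its derivative. -/
def jostCoeff (μ : ℝ) (q q' : ℝ → ℝ) (F₀ F₁ : Space n → ℂ) (ξ : Space n) : ℂ :=
  (q' (freq ξ) : ℂ) * F₀ ξ - ((q (freq ξ) / freq ξ : ℝ) : ℂ) * (F₁ ξ + μ * F₀ ξ)

/-- The pointwise size of the Cauchy data. -/
def dataSize (F₀ F₁ : Space n → ℂ) (ξ : Space n) : ℝ :=
  ‖F₀ ξ‖ + ‖((bracket ξ)⁻¹ : ℂ) * F₁ ξ‖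

theorem dataSize_nonneg (F₀ F₁ : Space n → ℂ) (ξ : Space n) : 0 ≤ dataSize F₀ F₁ ξ := by
  unfold dataSize
  positivity

variable {F₀ F₁ : Space n → ℂ} {δ : ℝ}

/-- The velocity enters divided by the frequency. Away from the origin `1 / freq ξ` is comparable to
`1 / bracket ξ`, so the `H⁻¹` size of the velocity is enough. -/
theorem norm_jostCoeff_le {μ C : ℝ} {q q' : ℝ → ℝ} (hδ : 0 < δ) (hC0 : 0 ≤ C)
    (hC : ∀ x, 2 * Real.pi * δ ≤ x → |q x| ≤ C ∧ |q' x| ≤ C) {ξ : Space n} (hξ : δ ≤ ‖ξ‖) :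
    ‖jostCoeff μ q q' F₀ F₁ ξ‖ ≤ C * (1 + (1 + δ⁻¹) * (1 + |μ|)) * dataSize F₀ F₁ ξ := by
  obtain ⟨h1, h2⟩ := hC _ (le_freq hξ)
  have hb := bracket_pos ξ
  have hξ0 : 0 < ‖ξ‖ := hδ.trans_le hξ
  -- From `bracket ξ ≤ 1 + ‖ξ‖` and `1 ≤ δ⁻¹ * ‖ξ‖`; the constant blows up as `δ → 0`.
  have hbr : bracket ξ ≤ (1 + δ⁻¹) * ‖ξ‖ := by
    refine (Real.sqrt_le_sqrt (y := (1 + ‖ξ‖) ^ 2) (by nlinarith)).trans ?_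
    rw [Real.sqrt_sq (by positivity), add_mul, one_mul, add_comm]
    gcongr
    rw [inv_mul_eq_div, one_le_div hδ]
    exact hξ
  have hf0 : 0 < freq ξ := mul_pos (by positivity) hξ0
  have hfreq : (freq ξ)⁻¹ ≤ (1 + δ⁻¹) * (bracket ξ)⁻¹ := by
    rw [← div_eq_mul_inv, inv_le_comm₀ hf0 (by positivity), inv_div, div_le_iff₀ (by positivity)]
    refine hbr.trans ?_
    rw [mul_comm, freq]
    gcongr
    nlinarith [Real.pi_gt_three]
  have hfreq1 : (freq ξ)⁻¹ ≤ 1 + δ⁻¹ :=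
    hfreq.trans (mul_le_of_le_one_right (by positivity)
      (inv_le_one_of_one_le₀ (one_le_bracket ξ)))
  have hsz : dataSize F₀ F₁ ξ = ‖F₀ ξ‖ + (bracket ξ)⁻¹ * ‖F₁ ξ‖ := by
    rw [dataSize, norm_mul, norm_inv, Complex.norm_real, Real.norm_of_nonneg hb.le]
  rw [jostCoeff, hsz]
  calc _ ≤ |q' (freq ξ)| * ‖F₀ ξ‖ + |q (freq ξ)| * ((freq ξ)⁻¹ * (‖F₁ ξ‖ + |μ| * ‖F₀ ξ‖)) := by
        refine (norm_sub_le _ _).trans (add_le_add (by simp) ?_)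
        rw [norm_mul, Complex.norm_real, norm_div, Real.norm_eq_abs, Real.norm_of_nonneg hf0.le,
          div_eq_mul_inv, mul_assoc]
        gcongr
        refine (norm_add_le _ _).trans (by simp)
    _ ≤ C * ‖F₀ ξ‖ + C * ((1 + δ⁻¹) * ((bracket ξ)⁻¹ * ‖F₁ ξ‖) +
        (1 + δ⁻¹) * (|μ| * ‖F₀ ξ‖)) := by
        have h5 : (freq ξ)⁻¹ * ‖F₁ ξ‖ ≤ (1 + δ⁻¹) * ((bracket ξ)⁻¹ * ‖F₁ ξ‖) := by
          rw [← mul_assoc]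
          gcongr
        have h6 : (freq ξ)⁻¹ * (|μ| * ‖F₀ ξ‖) ≤ (1 + δ⁻¹) * (|μ| * ‖F₀ ξ‖) := by gcongr
        rw [mul_add (freq ξ)⁻¹]
        gcongr
    _ ≤ _ := by
        have e : C * (1 + (1 + δ⁻¹) * (1 + |μ|)) * (‖F₀ ξ‖ + (bracket ξ)⁻¹ * ‖F₁ ξ‖) -
            (C * ‖F₀ ξ‖ + C * ((1 + δ⁻¹) * ((bracket ξ)⁻¹ * ‖F₁ ξ‖) +
              (1 + δ⁻¹) * (|μ| * ‖F₀ ξ‖))) =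
            C * ((1 + δ⁻¹) * ‖F₀ ξ‖ + (1 + (1 + δ⁻¹) * |μ|) * ((bracket ξ)⁻¹ * ‖F₁ ξ‖)) := by
          ring
        have : 0 ≤ C * ((1 + δ⁻¹) * ‖F₀ ξ‖ +
          (1 + (1 + δ⁻¹) * |μ|) * ((bracket ξ)⁻¹ * ‖F₁ ξ‖)) := by positivity
        linarith

theorem jostCoeff_eq_zero {μ : ℝ} {q q' : ℝ → ℝ} {ξ : Space n} (h₀ : F₀ ξ = 0) (h₁ : F₁ ξ = 0) :
    jostCoeff μ q q' F₀ F₁ ξ = 0 := by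
  simp [jostCoeff, h₀, h₁]

/-- Cauchy data on the Fourier side, supported away from a ball of radius `δ`. -/
structure IsFourierData (δ : ℝ) (F₀ F₁ : Space n → ℂ) : Prop where
  memLp : MemLp F₀ 2
  weightedL2 : WeightedL2 F₁
  memLp_inv : MemLp (fun ξ => ((bracket ξ)⁻¹ : ℂ) * F₁ ξ) 2
  support : ∀ᵐ ξ, (F₀ ξ = 0 ∧ F₁ ξ = 0) ∨ δ ≤ ‖ξ‖

theorem IsFourierData.memLp_dataSize (hF : IsFourierData δ F₀ F₁) : MemLp (dataSize F₀ F₁) 2 :=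
  hF.memLp.norm.add hF.memLp_inv.norm

theorem IsFourierData.eLpNorm_le (hF : IsFourierData δ F₀ F₁) {c : ℝ} {f : Space n → ℂ}
    (h : ∀ᵐ ξ, ‖f ξ‖ ≤ c * dataSize F₀ F₁ ξ) :
    eLpNorm f 2 ≤ ENNReal.ofReal c *
      (eLpNorm F₀ 2 + eLpNorm (fun ξ => ((bracket ξ)⁻¹ : ℂ) * F₁ ξ) 2) := by
  refine (eLpNorm_le_mul_eLpNorm_of_ae_le_mul (g := dataSize F₀ F₁) (c := c) ?_ 2).trans ?_
  · filter_upwards [h] with ξ hξ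
    rwa [Real.norm_of_nonneg (dataSize_nonneg _ _ ξ)]
  · gcongr
    refine (eLpNorm_add_le hF.memLp.norm.1 hF.memLp_inv.norm.1 (by norm_num)).trans ?_
    rw [eLpNorm_norm, eLpNorm_norm]

variable {μ C : ℝ} {q q' : ℝ → ℝ}

theorem IsFourierData.norm_jostCoeff_le (hF : IsFourierData δ F₀ F₁) (hδ : 0 < δ) (hC0 : 0 ≤ C)
    (hC : ∀ x, 2 * Real.pi * δ ≤ x → |q x| ≤ C ∧ |q' x| ≤ C) :
    ∀ᵐ ξ, ‖jostCoeff μ q q' F₀ F₁ ξ‖ ≤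
      C * (1 + (1 + δ⁻¹) * (1 + |μ|)) * dataSize F₀ F₁ ξ := by
  filter_upwards [hF.support] with ξ hξ
  rcases hξ with ⟨h₀, h₁⟩ | hξ
  · rw [jostCoeff_eq_zero h₀ h₁, norm_zero]
    have := dataSize_nonneg F₀ F₁ ξ
    positivity
  · exact WeakDamping.norm_jostCoeff_le hδ hC0 hC hξ

theorem IsFourierData.memLp_jostCoeff (hF : IsFourierData δ F₀ F₁) (hδ : 0 < δ)
    (hq : Measurable q) (hq' : Measurable q') (hC0 : 0 ≤ C)
    (hC : ∀ x, 2 * Real.pi * δ ≤ x → |q x| ≤ C ∧ |q' x| ≤ C) :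
    MemLp (jostCoeff μ q q' F₀ F₁) 2 := by
  refine (hF.memLp_dataSize.const_mul (C * (1 + (1 + δ⁻¹) * (1 + |μ|)))).mono' ?_
    (hF.norm_jostCoeff_le hδ hC0 hC)
  have h1 := hF.memLp.1
  have h2 := hF.weightedL2.aestronglyMeasurable
  have h3 : AEStronglyMeasurable fun ξ : Space n => (q' (freq ξ) : ℂ) :=
    (Complex.measurable_ofReal.comp (hq'.comp measurable_freq)).aestronglyMeasurable
  have h4 : AEStronglyMeasurable fun ξ : Space n => ((q (freq ξ) / freq ξ : ℝ) : ℂ) :=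
    (Complex.measurable_ofReal.comp
      ((hq.comp measurable_freq).div measurable_freq)).aestronglyMeasurable
  exact (h3.mul h1).sub (h4.mul (h2.add (h1.const_mul _)))

theorem IsFourierData.support_jostCoeff (hF : IsFourierData δ F₀ F₁) :
    ∀ᵐ ξ, jostCoeff μ q q' F₀ F₁ ξ ≠ 0 → δ ≤ ‖ξ‖ := by
  filter_upwards [hF.support] with ξ hξ h
  exact hξ.resolve_left fun h' => h (jostCoeff_eq_zero h'.1 h'.2)

/-- A family of functions that depends linearly on a parameter, up to null sets, as a linear map
to the tempered distributions with these Fourier transforms. -/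
def fourierInvLinearMap {V : Type*} [AddCommGroup V] [Module ℂ V] (f : V → Space n → ℂ)
    (hf : ∀ v, WeightedL2 (f v)) (hadd : ∀ v w, f (v + w) =ᵐ[volume] f v + f w)
    (hsmul : ∀ (c : ℂ) v, f (c • v) =ᵐ[volume] c • f v) : V →ₗ[ℂ] 𝓢'(Space n, ℂ) where
  toFun v := 𝓕⁻ (ofFun (f v))
  map_add' v w := by
    rw [ofFun_congr (hf _) (hadd v w), ofFun_add (hf v) (hf w), FourierTransform.fourierInv_add]
  map_smul' c v := by
    rw [ofFun_congr (hf _) (hsmul c v), ofFun_smul (hf v), FourierTransform.fourierInv_smul,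
      RingHom.id_apply]

end Scattering

/-! ### Free and damped waves with common Jost coefficients -/

section Main

variable {n : ℕ}

/-- The free wave `cos (t |ξ|) α + sin (t |ξ|) β`. -/
def freeWave (α β : Space n → ℂ) (t : ℝ) : Space n → ℂ :=
  mode (fun t k => Real.cos (t * k)) α t + mode (fun t k => Real.sin (t * k)) β t

/-- The time derivative of `freeWave`. -/
def freeWaveDeriv (α β : Space n → ℂ) (t : ℝ) : Space n → ℂ :=
  mode (fun t k => -(k * Real.sin (t * k))) α t + mode (fun t k => k * Real.cos (t * k)) β t

/-- The solution of the weakly damped wave equation built from two Jost solutions. -/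
def dampedWave (μ : ℝ) (p r : ℝ → ℝ) (α β : Space n → ℂ) (t : ℝ) : Space n → ℂ :=
  mode (fun t k => t ^ (-μ) * p (t * k)) α t + mode (fun t k => t ^ (-μ) * r (t * k)) β t

/-- The time derivative of `dampedWave`. -/
def dampedWaveDeriv (μ : ℝ) (p p' r r' : ℝ → ℝ) (α β : Space n → ℂ) (t : ℝ) : Space n → ℂ :=
  mode (fun t k => t ^ (-μ) * (k * p' (t * k) - μ / t * p (t * k))) α t +
    mode (fun t k => t ^ (-μ) * (k * r' (t * k) - μ / t * r (t * k))) β t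

theorem freeWave_add (α β α' β' : Space n → ℂ) (t : ℝ) :
    freeWave (α + α') (β + β') t = freeWave α β t + freeWave α' β' t := by
  ext ξ
  simp only [freeWave, mode, Pi.add_apply]
  ring

theorem freeWave_smul (c : ℂ) (α β : Space n → ℂ) (t : ℝ) :
    freeWave (c • α) (c • β) t = c • freeWave α β t := by
  ext ξ
  simp only [freeWave, mode, Pi.add_apply, Pi.smul_apply, smul_eq_mul]
  ring

theorem freeWaveDeriv_add (α β α' β' : Space n → ℂ) (t : ℝ) :
    freeWaveDeriv (α + α') (β + β') t = freeWaveDeriv α β t + freeWaveDeriv α' β' t := by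
  ext ξ
  simp only [freeWaveDeriv, mode, Pi.add_apply]
  ring

theorem freeWaveDeriv_smul (c : ℂ) (α β : Space n → ℂ) (t : ℝ) :
    freeWaveDeriv (c • α) (c • β) t = c • freeWaveDeriv α β t := by
  ext ξ
  simp only [freeWaveDeriv, mode, Pi.add_apply, Pi.smul_apply, smul_eq_mul]
  ring

theorem mode_congr {θ : ℝ → ℝ → ℝ} {α α' : Space n → ℂ} (h : α =ᵐ[volume] α') (t : ℝ) :
    mode θ α t =ᵐ[volume] mode θ α' t :=
  h.mono fun ξ hξ => by simp only [mode, hξ]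

theorem freeWave_congr {α β α' β' : Space n → ℂ} (h : α =ᵐ[volume] α') (h' : β =ᵐ[volume] β')
    (t : ℝ) : freeWave α β t =ᵐ[volume] freeWave α' β' t :=
  (mode_congr h t).add (mode_congr h' t)

theorem freeWaveDeriv_congr {α β α' β' : Space n → ℂ} (h : α =ᵐ[volume] α')
    (h' : β =ᵐ[volume] β') (t : ℝ) :
    freeWaveDeriv α β t =ᵐ[volume] freeWaveDeriv α' β' t :=
  (mode_congr h t).add (mode_congr h' t)

/-- Representatives of the Fourier transforms are chosen separately for each datum, so additivity is
available only up to null sets. -/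
theorem jostCoeff_add (μ : ℝ) (q q' : ℝ → ℝ) {F₀ F₁ G₀ G₁ H₀ H₁ : Space n → ℂ}
    (h₀ : H₀ =ᵐ[volume] F₀ + G₀) (h₁ : H₁ =ᵐ[volume] F₁ + G₁) :
    jostCoeff μ q q' H₀ H₁ =ᵐ[volume] jostCoeff μ q q' F₀ F₁ + jostCoeff μ q q' G₀ G₁ := by
  filter_upwards [h₀, h₁] with ξ e₀ e₁
  simp only [jostCoeff, Pi.add_apply, e₀, e₁]
  ring

theorem jostCoeff_smul (μ : ℝ) (q q' : ℝ → ℝ) (c : ℂ) {F₀ F₁ H₀ H₁ : Space n → ℂ}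
    (h₀ : H₀ =ᵐ[volume] c • F₀) (h₁ : H₁ =ᵐ[volume] c • F₁) :
    jostCoeff μ q q' H₀ H₁ =ᵐ[volume] c • jostCoeff μ q q' F₀ F₁ := by
  filter_upwards [h₀, h₁] with ξ e₀ e₁
  simp only [jostCoeff, Pi.smul_apply, e₀, e₁, smul_eq_mul]
  ring

/-- Coefficients in `L²`, supported away from a ball. -/
structure IsCoeff (δ : ℝ) (α : Space n → ℂ) : Prop where
  memLp : MemLp α 2
  support : ∀ᵐ ξ, α ξ ≠ 0 → δ ≤ ‖ξ‖

theorem IsCoeff.neg {δ : ℝ} {α : Space n → ℂ} (h : IsCoeff δ α) : IsCoeff δ (-α) :=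
  ⟨h.memLp.neg, h.support.mono fun _ hξ h0 => hξ (neg_ne_zero.1 h0)⟩

theorem IsFourierData.isCoeff {F₀ F₁ : Space n → ℂ} {δ μ C : ℝ} {q q' : ℝ → ℝ}
    (hF : IsFourierData δ F₀ F₁) (hδ : 0 < δ)
    (hq : Measurable q) (hq' : Measurable q') (hC0 : 0 ≤ C)
    (hC : ∀ x, 2 * Real.pi * δ ≤ x → |q x| ≤ C ∧ |q' x| ≤ C) :
    IsCoeff δ (jostCoeff μ q q' F₀ F₁) :=
  ⟨hF.memLp_jostCoeff hδ hq hq' hC0 hC, hF.support_jostCoeff⟩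

variable {δ : ℝ} {α β : Space n → ℂ}

theorem weightedL2_freeWave (hδ : 0 ≤ δ) (hα : IsCoeff δ α) (hβ : IsCoeff δ β) (t : ℝ) :
    WeightedL2 (freeWave α β t) :=
  ((oscProfile_cos (by positivity)).weightedL2 hα.memLp hα.support (Set.mem_univ t)).add
    ((oscProfile_sin (by positivity)).weightedL2 hβ.memLp hβ.support (Set.mem_univ t))

theorem weightedL2_freeWaveDeriv (hδ : 0 ≤ δ) (hα : IsCoeff δ α) (hβ : IsCoeff δ β) (t : ℝ) :
    WeightedL2 (freeWaveDeriv α β t) :=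
  ((oscProfile_cos (by positivity)).weightedL2_deriv hα.memLp hα.support (Set.mem_univ t)).add
    ((oscProfile_sin (by positivity)).weightedL2_deriv hβ.memLp hβ.support (Set.mem_univ t))

theorem fourierSolution_freeWave (hδ : 0 ≤ δ) (hα : IsCoeff δ α) (hβ : IsCoeff δ β) :
    FourierSolution Set.univ (fun _ => 0) (fun t => ofFun (freeWave α β t))
      (fun t => ofFun (freeWaveDeriv α β t)) := by
  have hc := oscProfile_cos (κ := 2 * Real.pi * δ) (by positivity)
  have hs := oscProfile_sin (κ := 2 * Real.pi * δ) (by positivity)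
  have h := (hc.fourierSolution hα.memLp hα.support).add
    (hs.fourierSolution hβ.memLp hβ.support)
  convert h using 2 with t t
  · exact ofFun_add (hc.weightedL2 hα.memLp hα.support (Set.mem_univ t))
      (hs.weightedL2 hβ.memLp hβ.support (Set.mem_univ t))
  · exact ofFun_add (hc.weightedL2_deriv hα.memLp hα.support (Set.mem_univ t))
      (hs.weightedL2_deriv hβ.memLp hβ.support (Set.mem_univ t))

/-- Two Jost solutions `p ∼ cos`, `r ∼ sin` of `q'' + (1 + (μ - μ ^ 2) / x ^ 2) q = 0`. -/
structure IsJostPair (μ : ℝ) (p p' r r' : ℝ → ℝ) : Prop where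
  measurable : Measurable p ∧ Measurable p' ∧ Measurable r ∧ Measurable r'
  hasDerivAt_fst : ∀ x, 0 < x → HasDerivAt p (p' x) x
  hasDerivAt_fst' : ∀ x, 0 < x → HasDerivAt p' (-((1 + (μ - μ ^ 2) / x ^ 2) * p x)) x
  hasDerivAt_snd : ∀ x, 0 < x → HasDerivAt r (r' x) x
  hasDerivAt_snd' : ∀ x, 0 < x → HasDerivAt r' (-((1 + (μ - μ ^ 2) / x ^ 2) * r x)) x
  wronskian : ∀ x, 0 < x → p x * r' x - p' x * r x = 1
  bound : ∀ ε, 0 < ε → ∃ C, 1 ≤ C ∧ ∀ x, ε ≤ x →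
    |p x - Real.cos x| ≤ C / x ∧ |r x - Real.sin x| ≤ C / x ∧
    |p x| ≤ C ∧ |p' x| ≤ C ∧ |r x| ≤ C ∧ |r' x| ≤ C

variable {μ : ℝ} {p p' r r' : ℝ → ℝ}

theorem IsJostPair.oscProfile_fst (h : IsJostPair μ p p' r r') (hδ : 0 < δ) :
    OscProfile (Set.Ioi 0) (2 * Real.pi * δ) (fun t => 2 * μ / t)
      (fun t k => t ^ (-μ) * p (t * k))
      (fun t k => t ^ (-μ) * (k * p' (t * k) - μ / t * p (t * k))) :=
  oscProfile_damped (by positivity) h.measurable.1 h.measurable.2.1 h.hasDerivAt_fst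
    h.hasDerivAt_fst' fun ε hε => by
      obtain ⟨C, hC1, hC⟩ := h.bound ε hε
      exact ⟨C, by linarith, fun x hx => ⟨(hC x hx).2.2.1, (hC x hx).2.2.2.1⟩⟩

theorem IsJostPair.oscProfile_snd (h : IsJostPair μ p p' r r') (hδ : 0 < δ) :
    OscProfile (Set.Ioi 0) (2 * Real.pi * δ) (fun t => 2 * μ / t)
      (fun t k => t ^ (-μ) * r (t * k))
      (fun t k => t ^ (-μ) * (k * r' (t * k) - μ / t * r (t * k))) :=
  oscProfile_damped (by positivity) h.measurable.2.2.1 h.measurable.2.2.2 h.hasDerivAt_snd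
    h.hasDerivAt_snd' fun ε hε => by
      obtain ⟨C, hC1, hC⟩ := h.bound ε hε
      exact ⟨C, by linarith, fun x hx => ⟨(hC x hx).2.2.2.2.1, (hC x hx).2.2.2.2.2⟩⟩

theorem IsJostPair.weightedL2_dampedWave (h : IsJostPair μ p p' r r') (hδ : 0 < δ)
    (hα : IsCoeff δ α) (hβ : IsCoeff δ β) {t : ℝ} (ht : 0 < t) :
    WeightedL2 (dampedWave μ p r α β t) :=
  ((h.oscProfile_fst hδ).weightedL2 hα.memLp hα.support ht).add
    ((h.oscProfile_snd hδ).weightedL2 hβ.memLp hβ.support ht)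

theorem IsJostPair.weightedL2_dampedWaveDeriv (h : IsJostPair μ p p' r r') (hδ : 0 < δ)
    (hα : IsCoeff δ α) (hβ : IsCoeff δ β) {t : ℝ} (ht : 0 < t) :
    WeightedL2 (dampedWaveDeriv μ p p' r r' α β t) :=
  ((h.oscProfile_fst hδ).weightedL2_deriv hα.memLp hα.support ht).add
    ((h.oscProfile_snd hδ).weightedL2_deriv hβ.memLp hβ.support ht)

/-- The expansion in Jost solutions, as a weak solution with prescribed data. -/
theorem IsJostPair.exists_fourierSolution (h : IsJostPair μ p p' r r') (hδ : 0 < δ)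
    {F₀ F₁ : Space n → ℂ} (hF : IsFourierData δ F₀ F₁)
    (hα : IsCoeff δ (jostCoeff μ r r' F₀ F₁)) (hβ : IsCoeff δ (-jostCoeff μ p p' F₀ F₁)) :
    ∃ D D₁ : ℝ → 𝓢'(Space n, ℂ), FourierSolution (Set.Ioi 0) (fun t => 2 * μ / t) D D₁ ∧
      (∀ t, 0 < t → D t =
        ofFun (dampedWave μ p r (jostCoeff μ r r' F₀ F₁) (-jostCoeff μ p p' F₀ F₁) t)) ∧
      D 1 = ofFun F₀ ∧ D₁ 1 = ofFun F₁ := by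
  have hp := h.oscProfile_fst hδ
  have hr := h.oscProfile_snd hδ
  refine ⟨_, _, (hp.fourierSolution hα.memLp hα.support).add
    (hr.fourierSolution hβ.memLp hβ.support), fun t ht => ?_, ?_, ?_⟩
  · exact (ofFun_add (hp.weightedL2 hα.memLp hα.support ht)
      (hr.weightedL2 hβ.memLp hβ.support ht)).symm
  · refine (ofFun_add (hp.weightedL2 hα.memLp hα.support (Set.mem_Ioi.2 one_pos))
      (hr.weightedL2 hβ.memLp hβ.support (Set.mem_Ioi.2 one_pos))).symm.trans ?_
    refine ofFun_congr (h.weightedL2_dampedWave hδ hα hβ one_pos) ?_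
    filter_upwards [hF.support] with ξ hξ
    rcases hξ with ⟨h₀, h₁⟩ | hξ
    · simp [mode, jostCoeff, h₀, h₁]
    · have hk : 0 < freq ξ := mul_pos (by positivity) (hδ.trans_le hξ)
      have hk' : (freq ξ : ℂ) ≠ 0 := by exact_mod_cast hk.ne'
      -- The coefficients solve the `2 × 2` system for the data at `t = 1` by Cramer's rule, with
      -- the Wronskian as determinant. The term `μ * F₀` inside them offsets the derivative of `t ^
      -- (-μ)`.
      have hw : (p (freq ξ) : ℂ) * r' (freq ξ) - p' (freq ξ) * r (freq ξ) = 1 := by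
        exact_mod_cast h.wronskian _ hk
      simp only [mode, jostCoeff, Pi.add_apply, Pi.neg_apply, Real.one_rpow, one_mul]
      push_cast
      field_simp
      linear_combination (F₀ ξ * freq ξ) * hw
  · refine (ofFun_add (hp.weightedL2_deriv hα.memLp hα.support (Set.mem_Ioi.2 one_pos))
      (hr.weightedL2_deriv hβ.memLp hβ.support (Set.mem_Ioi.2 one_pos))).symm.trans ?_
    refine ofFun_congr (h.weightedL2_dampedWaveDeriv hδ hα hβ one_pos) ?_
    filter_upwards [hF.support] with ξ hξ
    rcases hξ with ⟨h₀, h₁⟩ | hξ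
    · simp [mode, jostCoeff, h₀, h₁]
    · have hk : 0 < freq ξ := mul_pos (by positivity) (hδ.trans_le hξ)
      have hk' : (freq ξ : ℂ) ≠ 0 := by exact_mod_cast hk.ne'
      have hw : (p (freq ξ) : ℂ) * r' (freq ξ) - p' (freq ξ) * r (freq ξ) = 1 := by
        exact_mod_cast h.wronskian _ hk
      simp only [mode, jostCoeff, Pi.add_apply, Pi.neg_apply, Real.one_rpow, one_mul, div_one]
      push_cast
      field_simp
      linear_combination (F₁ ξ * freq ξ) * hw

variable {F₀ F₁ : Space n → ℂ} {A : ℝ}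

theorem norm_freeWave_le (hα : ∀ᵐ ξ, ‖α ξ‖ ≤ A * dataSize F₀ F₁ ξ)
    (hβ : ∀ᵐ ξ, ‖β ξ‖ ≤ A * dataSize F₀ F₁ ξ) (t : ℝ) :
    ∀ᵐ ξ, ‖freeWave α β t ξ‖ ≤ 2 * A * dataSize F₀ F₁ ξ := by
  filter_upwards [hα, hβ] with ξ h1 h2
  rw [freeWave, Pi.add_apply, mode, mode]
  refine (norm_add_le _ _).trans ?_
  rw [norm_mul, norm_mul, Complex.norm_real, Complex.norm_real]
  have h3 := mul_le_of_le_one_left (norm_nonneg (α ξ)) (Real.abs_cos_le_one (t * freq ξ))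
  have h4 := mul_le_of_le_one_left (norm_nonneg (β ξ)) (Real.abs_sin_le_one (t * freq ξ))
  simp only [Real.norm_eq_abs]
  linarith

/-- The time derivative brings out one factor `freq ξ`, which `(bracket ξ)⁻¹` reduces to at most `2
* π`. -/
theorem norm_freeWaveDeriv_le (hα : ∀ᵐ ξ, ‖α ξ‖ ≤ A * dataSize F₀ F₁ ξ)
    (hβ : ∀ᵐ ξ, ‖β ξ‖ ≤ A * dataSize F₀ F₁ ξ) (t : ℝ) :
    ∀ᵐ ξ, ‖((bracket ξ)⁻¹ : ℂ) * freeWaveDeriv α β t ξ‖ ≤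
      2 * Real.pi * (2 * A) * dataSize F₀ F₁ ξ := by
  filter_upwards [hα, hβ] with ξ h1 h2
  have hk0 : 0 ≤ freq ξ := by unfold freq; positivity
  have hb := bracket_pos ξ
  have hk : (bracket ξ)⁻¹ * freq ξ ≤ 2 * Real.pi := by
    rw [inv_mul_le_iff₀ hb, freq, mul_comm]
    gcongr
    exact norm_le_bracket ξ
  have e : freeWaveDeriv α β t ξ = (freq ξ : ℂ) *
      (-(Real.sin (t * freq ξ) : ℂ) * α ξ + (Real.cos (t * freq ξ) : ℂ) * β ξ) := by
    simp only [freeWaveDeriv, mode, Pi.add_apply]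
    push_cast
    ring
  have h5 : ‖-(Real.sin (t * freq ξ) : ℂ) * α ξ + (Real.cos (t * freq ξ) : ℂ) * β ξ‖ ≤
      2 * A * dataSize F₀ F₁ ξ := by
    refine (norm_add_le _ _).trans ?_
    rw [norm_mul, norm_mul, norm_neg, Complex.norm_real, Complex.norm_real]
    have h3 := mul_le_of_le_one_left (norm_nonneg (α ξ)) (Real.abs_sin_le_one (t * freq ξ))
    have h4 := mul_le_of_le_one_left (norm_nonneg (β ξ)) (Real.abs_cos_le_one (t * freq ξ))
    simp only [Real.norm_eq_abs]
    linarith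
  rw [e, norm_mul, norm_mul, norm_inv, Complex.norm_real, Complex.norm_real,
    Real.norm_of_nonneg hb.le, Real.norm_of_nonneg hk0, ← mul_assoc, mul_assoc (2 * Real.pi)]
  exact mul_le_mul hk h5 (norm_nonneg _) (by positivity)

/-- The factor `t ^ μ` cancels `t ^ (-μ)`, and since both waves share their coefficients only `p -
cos` and `r - sin` at `t * freq ξ` remain. These are at most `C / (t * freq ξ)`, and `freq ξ ≥ 2 * π
* δ` on the support. -/
theorem norm_dampedWave_sub_freeWave_le {C : ℝ} (hδ : 0 < δ)
    (hb : ∀ x, 2 * Real.pi * δ ≤ x →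
      |p x - Real.cos x| ≤ C / x ∧ |r x - Real.sin x| ≤ C / x)
    (hα0 : ∀ᵐ ξ, α ξ ≠ 0 → δ ≤ ‖ξ‖) (hβ0 : ∀ᵐ ξ, β ξ ≠ 0 → δ ≤ ‖ξ‖) (hC : 0 ≤ C)
    (hα : ∀ᵐ ξ, ‖α ξ‖ ≤ A * dataSize F₀ F₁ ξ)
    (hβ : ∀ᵐ ξ, ‖β ξ‖ ≤ A * dataSize F₀ F₁ ξ) {t : ℝ} (ht : 1 ≤ t) :
    ∀ᵐ ξ, ‖(((t ^ μ : ℝ) : ℂ) • dampedWave μ p r α β t - freeWave α β t) ξ‖ ≤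
      C / (2 * Real.pi * δ) * (2 * A) * t⁻¹ * dataSize F₀ F₁ ξ := by
  have ht0 : 0 < t := one_pos.trans_le ht
  filter_upwards [hα0, hβ0, hα, hβ] with ξ hα0 hβ0 hα hβ
  have e : (((t ^ μ : ℝ) : ℂ) • dampedWave μ p r α β t - freeWave α β t) ξ =
      ((p (t * freq ξ) - Real.cos (t * freq ξ) : ℝ) : ℂ) * α ξ +
        ((r (t * freq ξ) - Real.sin (t * freq ξ) : ℝ) : ℂ) * β ξ := by
    have h1 : ((t ^ μ : ℝ) : ℂ) * ((t ^ (-μ) : ℝ) : ℂ) = 1 := by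
      rw [← Complex.ofReal_mul, ← Real.rpow_add ht0]
      simp
    simp only [dampedWave, freeWave, mode, Pi.sub_apply, Pi.smul_apply, Pi.add_apply, smul_eq_mul]
    push_cast
    linear_combination (p (t * freq ξ) * α ξ + r (t * freq ξ) * β ξ) * h1
  have hterm : ∀ (x : ℝ) (a : ℂ), (δ ≤ ‖ξ‖ → |x| ≤ C / (t * freq ξ)) → (a ≠ 0 → δ ≤ ‖ξ‖) →
      ‖a‖ ≤ A * dataSize F₀ F₁ ξ →
      ‖(x : ℂ) * a‖ ≤ C / (2 * Real.pi * δ) * t⁻¹ * (A * dataSize F₀ F₁ ξ) := by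
    intro x a hx ha0 ha
    have hAd : 0 ≤ A * dataSize F₀ F₁ ξ := (norm_nonneg _).trans ha
    by_cases h0 : a = 0
    · rw [h0, mul_zero, norm_zero]
      positivity
    · rw [norm_mul, Complex.norm_real, Real.norm_eq_abs]
      refine mul_le_mul ((hx (ha0 h0)).trans ?_) ha (norm_nonneg _) (by positivity)
      rw [div_mul_eq_mul_div, ← div_eq_mul_inv, div_div, mul_comm t]
      exact div_le_div_of_nonneg_left hC (by positivity)
        (by nlinarith [mul_le_mul_of_nonneg_right (le_freq (ha0 h0)) ht0.le])
  -- As `t ≥ 1`, the argument stays in the range where the Jost asymptotics hold with constant `C`.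
  have harg : δ ≤ ‖ξ‖ → 2 * Real.pi * δ ≤ t * freq ξ := fun h =>
    (le_freq h).trans (le_mul_of_one_le_left (by unfold freq; positivity) ht)
  rw [e]
  refine (norm_add_le _ _).trans ((add_le_add
    (hterm _ _ (fun h => (hb _ (harg h)).1) hα0 hα)
    (hterm _ _ (fun h => (hb _ (harg h)).2) hβ0 hβ)).trans_eq ?_)
  ring

end Main

/-! ### Representation of the data, the operator and its bounds -/

section Data

variable {n : ℕ}

/-- `F₀` and `F₁` are the Fourier transforms of the Cauchy data `u₀ ∈ L²` and `u₁ ∈ H⁻¹`. -/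
structure Represents (F₀ F₁ : Space n → ℂ) (u₀ u₁ : 𝓢'(Space n, ℂ)) : Prop where
  memLp : MemLp F₀ 2
  weightedL2 : WeightedL2 F₁
  memLp_inv : MemLp (fun ξ => ((bracket ξ)⁻¹ : ℂ) * F₁ ξ) 2
  fourier_fst : 𝓕 u₀ = ofFun F₀
  fourier_snd : 𝓕 u₁ = ofFun F₁

variable {F₀ F₁ : Space n → ℂ} {u₀ u₁ : 𝓢'(Space n, ℂ)}

theorem exists_represents (h₀ : TemperedDistribution.MemSobolev 0 2 u₀)
    (h₁ : TemperedDistribution.MemSobolev (-1) 2 u₁) :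
    ∃ F₀ F₁ : Space n → ℂ, Represents F₀ F₁ u₀ u₁ := by
  obtain ⟨F₀, hF₀, e₀⟩ := exists_fourier_eq_ofFun h₀
  obtain ⟨F₁, hF₁, hF₁', e₁⟩ := exists_fourier_eq_ofFun_neg_one h₁
  exact ⟨F₀, F₁, hF₀, hF₁, hF₁', e₀, e₁⟩

theorem Represents.l2Norm_eq (h : Represents F₀ F₁ u₀ u₁) : l2Norm u₀ = eLpNorm F₀ 2 := by
  rw [← l2Norm_fourierInv_ofFun h.memLp, ← h.fourier_fst, FourierTransform.fourierInv_fourier_eq]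

theorem Represents.sobolevNorm_eq (h : Represents F₀ F₁ u₀ u₁) :
    sobolevNorm (-1) u₁ = eLpNorm (fun ξ => ((bracket ξ)⁻¹ : ℂ) * F₁ ξ) 2 := by
  rw [← sobolevNorm_fourierInv_ofFun h.weightedL2 h.memLp_inv, ← h.fourier_snd,
    FourierTransform.fourierInv_fourier_eq]

theorem Represents.isFourierData (h : Represents F₀ F₁ u₀ u₁) {δ : ℝ}
    (hδ : ∀ ξ ∈ fourierSupport u₀ ∪ fourierSupport u₁, δ ≤ ‖ξ‖) : IsFourierData δ F₀ F₁ where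
  memLp := h.memLp
  weightedL2 := h.weightedL2
  memLp_inv := h.memLp_inv
  support := by
    filter_upwards [ae_mem_dsupport (MemLp.weightedL2 h.memLp), ae_mem_dsupport h.weightedL2]
      with ξ h₀ h₁
    rw [← h.fourier_fst] at h₀
    rw [← h.fourier_snd] at h₁
    by_cases e₀ : F₀ ξ = 0
    · by_cases e₁ : F₁ ξ = 0
      · exact Or.inl ⟨e₀, e₁⟩
      · exact Or.inr (hδ ξ (Or.inr (h₁ e₁)))
    · exact Or.inr (hδ ξ (Or.inl (h₀ e₀)))

/-- The supports are closed, so a set of frequencies missing the origin misses a ball around it. -/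
theorem exists_le_norm_of_zero_notMem (h₀ : 0 ∉ fourierSupport u₀) (h₁ : 0 ∉ fourierSupport u₁) :
    ∃ δ : ℝ, 0 < δ ∧ ∀ ξ ∈ fourierSupport u₀ ∪ fourierSupport u₁, δ ≤ ‖ξ‖ := by
  have hc : IsClosed (fourierSupport u₀ ∪ fourierSupport u₁) :=
    Distribution.isClosed_dsupport.union Distribution.isClosed_dsupport
  obtain ⟨δ, hδ, hsub⟩ := Metric.isOpen_iff.1 hc.isOpen_compl 0 (by simp [h₀, h₁])
  refine ⟨δ, hδ, fun ξ hξ => not_lt.1 fun hlt => ?_⟩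
  exact hsub (mem_ball_zero_iff.2 hlt) hξ

theorem Represents.ae_eq {G₀ G₁ : Space n → ℂ} (h : Represents F₀ F₁ u₀ u₁)
    (h' : Represents G₀ G₁ u₀ u₁) : F₀ =ᵐ[volume] G₀ ∧ F₁ =ᵐ[volume] G₁ :=
  ⟨ae_eq_of_ofFun_eq (MemLp.weightedL2 h.memLp) (MemLp.weightedL2 h'.memLp)
      (h.fourier_fst.symm.trans h'.fourier_fst),
    ae_eq_of_ofFun_eq h.weightedL2 h'.weightedL2 (h.fourier_snd.symm.trans h'.fourier_snd)⟩

theorem Represents.add {G₀ G₁ : Space n → ℂ} {v₀ v₁ : 𝓢'(Space n, ℂ)}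
    (h : Represents F₀ F₁ u₀ u₁) (h' : Represents G₀ G₁ v₀ v₁) :
    Represents (F₀ + G₀) (F₁ + G₁) (u₀ + v₀) (u₁ + v₁) where
  memLp := h.memLp.add h'.memLp
  weightedL2 := h.weightedL2.add h'.weightedL2
  memLp_inv := (h.memLp_inv.add h'.memLp_inv).ae_eq (ae_of_all _ fun ξ => by
    simp only [Pi.add_apply]
    ring)
  fourier_fst := by
    rw [FourierTransform.fourier_add, h.fourier_fst, h'.fourier_fst,
      ofFun_add (MemLp.weightedL2 h.memLp) (MemLp.weightedL2 h'.memLp)]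
  fourier_snd := by
    rw [FourierTransform.fourier_add, h.fourier_snd, h'.fourier_snd,
      ofFun_add h.weightedL2 h'.weightedL2]

theorem Represents.smul (h : Represents F₀ F₁ u₀ u₁) (c : ℂ) :
    Represents (c • F₀) (c • F₁) (c • u₀) (c • u₁) where
  memLp := h.memLp.const_smul c
  weightedL2 := h.weightedL2.const_smul c
  memLp_inv := (h.memLp_inv.const_smul c).ae_eq (ae_of_all _ fun ξ => by
    simp only [Pi.smul_apply, smul_eq_mul]
    ring)
  fourier_fst := by
    rw [FourierTransform.fourier_smul, h.fourier_fst, ofFun_smul (MemLp.weightedL2 h.memLp)]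
  fourier_snd := by
    rw [FourierTransform.fourier_smul, h.fourier_snd, ofFun_smul h.weightedL2]

theorem exists_isJostPair (μ : ℝ) : ∃ p p' r r' : ℝ → ℝ, IsJostPair μ p p' r r' := by
  obtain ⟨p, p', r, r', h1, h2, h3, h4, h5, h6, h7⟩ := exists_jost_pair (μ - μ ^ 2)
  exact ⟨p, p', r, r', h1, h2, h3, h4, h5, h6, h7⟩

theorem IsJostPair.isCoeff {μ δ : ℝ} {p p' r r' : ℝ → ℝ} (hJ : IsJostPair μ p p' r r')
    (hF : IsFourierData δ F₀ F₁) (hδ : 0 < δ) :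
    IsCoeff δ (jostCoeff μ r r' F₀ F₁) ∧ IsCoeff δ (-jostCoeff μ p p' F₀ F₁) := by
  obtain ⟨C, hC1, hC⟩ := hJ.bound (2 * Real.pi * δ) (by positivity)
  exact ⟨hF.isCoeff hδ hJ.measurable.2.2.1 hJ.measurable.2.2.2 (by linarith)
      fun x hx => ⟨(hC x hx).2.2.2.2.1, (hC x hx).2.2.2.2.2⟩,
    (hF.isCoeff hδ hJ.measurable.1 hJ.measurable.2.1 (by linarith)
      fun x hx => ⟨(hC x hx).2.2.1, (hC x hx).2.2.2.1⟩).neg⟩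

/-- Representatives of the same distribution agree almost everywhere, so the inverse Fourier
transform does not see the choice and the construction is linear. The radius `δ` may vary with `v`:
it serves only for integrability and does not enter the formula. -/
theorem exists_linearMap_freeWave {V : Type*} [AddCommGroup V] [Module ℂ V] (μ : ℝ)
    (p p' r r' : ℝ → ℝ) (F₀ F₁ : V → Space n → ℂ)
    (hcoeff : ∀ v, ∃ δ : ℝ, 0 ≤ δ ∧ IsCoeff δ (jostCoeff μ r r' (F₀ v) (F₁ v)) ∧
      IsCoeff δ (-jostCoeff μ p p' (F₀ v) (F₁ v)))
    (U : V →ₗ[ℂ] 𝓢'(Space n, ℂ) × 𝓢'(Space n, ℂ))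
    (hF : ∀ v, Represents (F₀ v) (F₁ v) (U v).1 (U v).2) :
    ∃ W : V →ₗ[ℂ] 𝓢'(Space n, ℂ) × 𝓢'(Space n, ℂ), ∀ v,
      W v = (𝓕⁻ (ofFun (freeWave (jostCoeff μ r r' (F₀ v) (F₁ v))
          (-jostCoeff μ p p' (F₀ v) (F₁ v)) 1)),
        𝓕⁻ (ofFun (freeWaveDeriv (jostCoeff μ r r' (F₀ v) (F₁ v))
          (-jostCoeff μ p p' (F₀ v) (F₁ v)) 1))) := by
  have hadd : ∀ v w, F₀ (v + w) =ᵐ[volume] F₀ v + F₀ w ∧ F₁ (v + w) =ᵐ[volume] F₁ v + F₁ w :=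
    fun v w => by
      have h := hF (v + w)
      rw [map_add] at h
      exact h.ae_eq ((hF v).add (hF w))
  have hsmul : ∀ (c : ℂ) v, F₀ (c • v) =ᵐ[volume] c • F₀ v ∧ F₁ (c • v) =ᵐ[volume] c • F₁ v :=
    fun c v => by
      have h := hF (c • v)
      rw [map_smul] at h
      exact h.ae_eq ((hF v).smul c)
  have hαadd := fun v w => jostCoeff_add μ r r' (hadd v w).1 (hadd v w).2
  have hαsmul := fun (c : ℂ) v => jostCoeff_smul μ r r' c (hsmul c v).1 (hsmul c v).2
  have hβadd : ∀ v w, -jostCoeff μ p p' (F₀ (v + w)) (F₁ (v + w)) =ᵐ[volume]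
      -jostCoeff μ p p' (F₀ v) (F₁ v) + -jostCoeff μ p p' (F₀ w) (F₁ w) := fun v w => by
    rw [← neg_add]
    exact (jostCoeff_add μ p p' (hadd v w).1 (hadd v w).2).neg
  have hβsmul : ∀ (c : ℂ) v, -jostCoeff μ p p' (F₀ (c • v)) (F₁ (c • v)) =ᵐ[volume]
      c • -jostCoeff μ p p' (F₀ v) (F₁ v) := fun c v => by
    rw [smul_neg]
    exact (jostCoeff_smul μ p p' c (hsmul c v).1 (hsmul c v).2).neg
  refine ⟨(fourierInvLinearMap _ (fun v => ?_)
    (fun v w => (freeWave_congr (hαadd v w) (hβadd v w) 1).trans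
      (freeWave_add _ _ _ _ 1).eventuallyEq)
    (fun c v => (freeWave_congr (hαsmul c v) (hβsmul c v) 1).trans
      (freeWave_smul c _ _ 1).eventuallyEq)).prod
    (fourierInvLinearMap _ (fun v => ?_)
    (fun v w => (freeWaveDeriv_congr (hαadd v w) (hβadd v w) 1).trans
      (freeWaveDeriv_add _ _ _ _ 1).eventuallyEq)
    (fun c v => (freeWaveDeriv_congr (hαsmul c v) (hβsmul c v) 1).trans
      (freeWaveDeriv_smul c _ _ 1).eventuallyEq)), fun v => rfl⟩
  · obtain ⟨δ, hδ, hα, hβ⟩ := hcoeff v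
    exact weightedL2_freeWave hδ hα hβ 1
  · obtain ⟨δ, hδ, hα, hβ⟩ := hcoeff v
    exact weightedL2_freeWaveDeriv hδ hα hβ 1

theorem exists_represents_admissibleData (n : ℕ) :
    ∃ F₀ F₁ : admissibleData n → Space n → ℂ, ∀ d, Represents (F₀ d) (F₁ d) d.1.1 d.1.2 := by
  have hrep : ∀ d : admissibleData n, ∃ F₀ F₁ : Space n → ℂ, Represents F₀ F₁ d.1.1 d.1.2 :=
    fun d => exists_represents d.2.1.1 d.2.1.2
  choose F₀ F₁ hF using hrep
  exact ⟨F₀, F₁, hF⟩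

theorem IsJostPair.exists_isCoeff {μ : ℝ} {p p' r r' : ℝ → ℝ} (hJ : IsJostPair μ p p' r r')
    {d : admissibleData n} (hF : Represents F₀ F₁ d.1.1 d.1.2) :
    ∃ δ : ℝ, 0 ≤ δ ∧ IsCoeff δ (jostCoeff μ r r' F₀ F₁) ∧ IsCoeff δ (-jostCoeff μ p p' F₀ F₁) := by
  obtain ⟨δ, hδ, hsub⟩ := exists_le_norm_of_zero_notMem d.2.2.1 d.2.2.2
  exact ⟨δ, hδ.le, hJ.isCoeff (hF.isFourierData hsub) hδ⟩

theorem IsJostPair.exists_linearMap {μ : ℝ} {p p' r r' : ℝ → ℝ} (hJ : IsJostPair μ p p' r r') :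
    ∃ W : admissibleData n →ₗ[ℂ] 𝓢'(Space n, ℂ) × 𝓢'(Space n, ℂ), ∀ d : admissibleData n,
      ∃ F₀ F₁ : Space n → ℂ, Represents F₀ F₁ d.1.1 d.1.2 ∧
        W d = (𝓕⁻ (ofFun (freeWave (jostCoeff μ r r' F₀ F₁) (-jostCoeff μ p p' F₀ F₁) 1)),
          𝓕⁻ (ofFun (freeWaveDeriv (jostCoeff μ r r' F₀ F₁) (-jostCoeff μ p p' F₀ F₁) 1))) := by
  obtain ⟨F₀, F₁, hF⟩ := exists_represents_admissibleData n
  obtain ⟨W, hW⟩ := exists_linearMap_freeWave μ p p' r r' F₀ F₁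
    (fun d => hJ.exists_isCoeff (hF d))
    (admissibleData n).subtype hF
  exact ⟨W, fun d => ⟨F₀ d, F₁ d, hF d, hW d⟩⟩

theorem IsJostPair.exists_bound {μ ε : ℝ} {p p' r r' : ℝ → ℝ} (hJ : IsJostPair μ p p' r r')
    (hε : 0 < ε) :
    ∃ C : ℝ≥0, ∀ (F₀ F₁ : Space n → ℂ) (u₀ u₁ w₀ w₁ : 𝓢'(Space n, ℂ)), Represents F₀ F₁ u₀ u₁ →
      w₀ = 𝓕⁻ (ofFun (freeWave (jostCoeff μ r r' F₀ F₁) (-jostCoeff μ p p' F₀ F₁) 1)) →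
      w₁ = 𝓕⁻ (ofFun (freeWaveDeriv (jostCoeff μ r r' F₀ F₁) (-jostCoeff μ p p' F₀ F₁) 1)) →
      (∀ ξ ∈ fourierSupport u₀ ∪ fourierSupport u₁, ε ≤ ‖ξ‖) →
      (l2Norm w₀ + sobolevNorm (-1) w₁ ≤ C * (l2Norm u₀ + sobolevNorm (-1) u₁)) ∧
      ∃ w : ℝ → 𝓢'(Space n, ℂ), SolvesCauchyProblem (fun _ => 0) Set.univ w w₀ w₁ ∧
        ∀ u : ℝ → 𝓢'(Space n, ℂ),
          SolvesCauchyProblem (fun t => 2 * μ / t) (Set.Ici 1) u u₀ u₁ →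
          ∀ t : ℝ, 1 ≤ t → l2Norm (((t ^ μ : ℝ) : ℂ) • u t - w t) ≤
            C * ENNReal.ofReal t⁻¹ * (l2Norm u₀ + sobolevNorm (-1) u₁) := by
  obtain ⟨C, hC1, hC⟩ := hJ.bound (2 * Real.pi * ε) (by positivity)
  have hC0 : 0 ≤ C := by linarith
  let A : ℝ := C * (1 + (1 + ε⁻¹) * (1 + |μ|))
  have hA : 0 ≤ A := by positivity
  -- `K₁` adds the bounds for the position and the velocity of the free wave at `t = 1`, and `K₂` is
  -- the constant of the asymptotic comparison. Their sum serves for both claims.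
  let K₁ : ℝ := 2 * A + 2 * Real.pi * (2 * A)
  let K₂ : ℝ := C / (2 * Real.pi * ε) * (2 * A)
  have hK₁ : 0 ≤ K₁ := by positivity
  have hK₂ : 0 ≤ K₂ := by positivity
  refine ⟨(K₁ + K₂).toNNReal, fun F₀ F₁ u₀ u₁ w₀ w₁ hF hw₀ hw₁ hd => ?_⟩
  have hK₁le : ENNReal.ofReal K₁ ≤ ((K₁ + K₂).toNNReal : ℝ≥0∞) :=
    ENNReal.ofReal_le_ofReal (by linarith)
  have hK₂le : ENNReal.ofReal K₂ ≤ ((K₁ + K₂).toNNReal : ℝ≥0∞) :=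
    ENNReal.ofReal_le_ofReal (by linarith)
  let α : Space n → ℂ := jostCoeff μ r r' F₀ F₁
  let β : Space n → ℂ := -jostCoeff μ p p' F₀ F₁
  have hD := hF.isFourierData hd
  obtain ⟨hα, hβ⟩ : IsCoeff ε α ∧ IsCoeff ε β := hJ.isCoeff hD hε
  have hαle : ∀ᵐ ξ, ‖α ξ‖ ≤ A * dataSize F₀ F₁ ξ :=
    hD.norm_jostCoeff_le hε hC0 fun x hx => ⟨(hC x hx).2.2.2.2.1, (hC x hx).2.2.2.2.2⟩
  have hβle : ∀ᵐ ξ, ‖β ξ‖ ≤ A * dataSize F₀ F₁ ξ := by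
    filter_upwards [hD.norm_jostCoeff_le (μ := μ) hε hC0
      fun x hx => ⟨(hC x hx).2.2.1, (hC x hx).2.2.2.1⟩] with ξ hξ
    rwa [← norm_neg] at hξ
  have hw := weightedL2_freeWave hε.le hα hβ
  rw [hF.l2Norm_eq, hF.sobolevNorm_eq]
  refine ⟨?_, fun t => 𝓕⁻ (ofFun (freeWave α β t)),
    hw₀ ▸ hw₁ ▸ (fourierSolution_freeWave hε.le hα hβ).solvesCauchyProblem, fun u hu t ht => ?_⟩
  · have hb₀ := norm_freeWave_le hαle hβle 1
    have hb₁ := norm_freeWaveDeriv_le hαle hβle 1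
    have hwd₁ := weightedL2_freeWaveDeriv hε.le hα hβ 1
    have hm₀ : MemLp (freeWave α β 1) 2 :=
      (hD.memLp_dataSize.const_mul (2 * A)).mono' (hw 1).aestronglyMeasurable hb₀
    have hm₁ : MemLp (fun ξ => ((bracket ξ)⁻¹ : ℂ) * freeWaveDeriv α β 1 ξ) 2 :=
      (hD.memLp_dataSize.const_mul (2 * Real.pi * (2 * A))).mono'
        ((Complex.measurable_ofReal.comp
          continuous_bracket.measurable).inv.aestronglyMeasurable.mul hwd₁.aestronglyMeasurable) hb₁
    rw [hw₀, hw₁, l2Norm_fourierInv_ofFun hm₀, sobolevNorm_fourierInv_ofFun hwd₁ hm₁]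
    refine (add_le_add (hD.eLpNorm_le hb₀) (hD.eLpNorm_le hb₁)).trans ?_
    rw [← add_mul, ← ENNReal.ofReal_add (by positivity) (by positivity)]
    gcongr
  · have ht0 : 0 < t := one_pos.trans_le ht
    -- By uniqueness the Fourier transform of any solution `u` is this expansion in Jost solutions.
    obtain ⟨D, D₁, hsol, hDt, hD0, hD1⟩ := hJ.exists_fourierSolution hε hD hα hβ
    have hut := hsol.fourier_eq hu (hD0.trans hF.fourier_fst.symm)
      (hD1.trans hF.fourier_snd.symm) t ht
    have hwd := hJ.weightedL2_dampedWave hε hα hβ ht0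
    have e : ((t ^ μ : ℝ) : ℂ) • u t - 𝓕⁻ (ofFun (freeWave α β t)) =
        𝓕⁻ (ofFun (((t ^ μ : ℝ) : ℂ) • dampedWave μ p r α β t -
          freeWave α β t)) := by
      rw [ofFun_sub (hwd.const_smul _) (hw t), ofFun_smul hwd, sub_eq_add_neg, sub_eq_add_neg,
        FourierTransform.fourierInv_add, FourierTransform.fourierInv_neg,
        FourierTransform.fourierInv_smul, ← hDt t ht0, ← hut,
        FourierTransform.fourierInv_fourier_eq]
    have hb := norm_dampedWave_sub_freeWave_le (μ := μ) hε
      (fun x hx => ⟨(hC x hx).1, (hC x hx).2.1⟩) hα.support hβ.support hC0 hαle hβle ht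
    have hm := (hD.memLp_dataSize.const_mul (K₂ * t⁻¹)).mono'
      ((hwd.const_smul _).sub (hw t)).aestronglyMeasurable hb
    rw [e, l2Norm_fourierInv_ofFun hm]
    refine (hD.eLpNorm_le hb).trans ?_
    rw [ENNReal.ofReal_mul (by positivity)]
    gcongr

end Data

end WeakDamping

end

theorem mainTheorem11 (n : ℕ) (μ : ℝ) :
    ∃ W : WeakDamping.admissibleData n →ₗ[ℂ]
        𝓢'(WeakDamping.Space n, ℂ) × 𝓢'(WeakDamping.Space n, ℂ),
      ∀ ε : ℝ, 0 < ε → ∃ C : ℝ≥0, ∀ d : WeakDamping.admissibleData n,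
        (∀ ξ ∈ WeakDamping.fourierSupport d.1.1 ∪ WeakDamping.fourierSupport d.1.2, ε ≤ ‖ξ‖) →
        (WeakDamping.l2Norm (W d).1 + WeakDamping.sobolevNorm (-1) (W d).2 ≤
          C * (WeakDamping.l2Norm d.1.1 + WeakDamping.sobolevNorm (-1) d.1.2)) ∧
        ∃ w : ℝ → 𝓢'(WeakDamping.Space n, ℂ),
          WeakDamping.SolvesCauchyProblem (fun _ => 0) Set.univ w (W d).1 (W d).2 ∧
          ∀ u : ℝ → 𝓢'(WeakDamping.Space n, ℂ),
            WeakDamping.SolvesCauchyProblem (fun t => 2 * μ / t) (Set.Ici 1) u d.1.1 d.1.2 →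
            ∀ t : ℝ, 1 ≤ t →
              WeakDamping.l2Norm (((t ^ μ : ℝ) : ℂ) • u t - w t) ≤
                C * ENNReal.ofReal t⁻¹ *
                  (WeakDamping.l2Norm d.1.1 + WeakDamping.sobolevNorm (-1) d.1.2) := by
  obtain ⟨p, p', r, r', hJ⟩ := WeakDamping.exists_isJostPair μ
  obtain ⟨W, hW⟩ := hJ.exists_linearMap (n := n)
  -- The Jost pair depends on `μ` alone, so `W` is fixed before `ε`; only the constant depends on
  -- `ε`.
  refine ⟨W, fun ε hε => ?_⟩
  obtain ⟨C, hC⟩ := hJ.exists_bound (n := n) hε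
  refine ⟨C, fun d hd => ?_⟩
  obtain ⟨F₀, F₁, hF, hWd⟩ := hW d
  exact hC F₀ F₁ _ _ _ _ hF (congrArg Prod.fst hWd) (congrArg Prod.snd hWd) hd
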